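/- Let $\mathbf D\subset\mathbb R^2\cong\mathbb C$ be a radial domain (open, connected, nonempty and invariant under rotations about the origin, e.g. the plane, a disc or an annulus), let $K_0:(0,\infty)\to\mathbb R$ and $K_1:\mathbf D\times\mathbf D\to\mathbb R$, and let $\alpha\in(0,1)$. Assume: (A1) $K_0$ is differentiable on $(0,\infty)$ and $-K_0'$ is a nonzero completely monotone function, i.e. it is $C^\infty$ on $(0,\infty)$, not identically zero, and $(-1)^m(-K_0')^{(m)}(t)\ge 0$ for all $t>0$ and all integers $m\ge 0$; (A2) $\int_0^1|K_0(t)|\,t^{-\alpha+\alpha^2}\,dt<\infty$; (A3) $K_1\in C^k_{\mathrm{loc}}(\mathbf D^2)$ for some $k\ge4$; (A4) $K_1(x,y)=K_1(y,x)$, $K_1(\bar x,\bar y)=K_1(x,y)$ and $K_1(e^{i\theta}x,e^{i\theta}y)=K_1(x,y)$ for all $x,y\in\mathbf D$ and $\theta\in\mathbb R$. For $0<b\le 1$ and integers $n\ge1$ put $$\lambda_{n,b}=\int_0^{2\pi}K_0\big(2b|\sin\tfrac\eta2|\big)e^{in\eta}\,d\eta,\qquad \widetilde\lambda_{n,b}=\int_0^{2\pi}K_0\big(|b-e^{i\eta}|\big)e^{in\eta}\,d\eta,$$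 and, if $\{x: b\le|x|\le 1\}\subset\mathbf D$, $$p_{n,b}=\int_0^{2\pi}K_1(b,be^{i\eta})e^{in\eta}\,d\eta,\qquad \widetilde p_{n,b}=\int_0^{2\pi}K_1(b,e^{i\eta})e^{in\eta}\,d\eta.$$ Then for every $0<b\le1$ the numbers $\lambda_{n,b}$ and $\widetilde\lambda_{n,b}$ are real, and there is a constant $C\ge1$, independent of $n$ (it may depend on $b,\alpha,K_0,K_1$), such that for all integers $n\ge1$ $$\frac1{Cn^2}\le\lambda_{n,b}\le\frac{C}{n^{\alpha-\alpha^2}},\qquad \frac1{Cn^3}\le\lambda_{n,b}-\lambda_{n+1,b}\le\frac{C}{n^{1+\alpha-\alpha^2}},$$ and, if $\{x:b\le|x|\le1\}\subset\mathbf D$, $$|p_{n,b}|+|\widetilde p_{n,b}|\le\frac{C}{n^4}.$$ Moreover $\widetilde\lambda_{n,b}>0$ for all $0<b\le 1$ and $n\ge1$; and if $0<b<1$, then for every integer $k\ge1$ there is a constant $C_{k,b}>0$, independent of $n$, with $\widetilde\lambda_{n,b}\le C_{k,b}\,n^{-k}$ for all $n\ge1$. -/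

import Mathlib

open Set MeasureTheory
open scoped ContDiff

noncomputable section

/-- A completely monotone function on `(0, ∞)`: smooth there, with `(-1)^n f^{(n)} ≥ 0` there. -/
def CompletelyMonotone (f : ℝ → ℝ) : Prop :=
  ContDiffOn ℝ ∞ f (Ioi 0) ∧
    ∀ n : ℕ, ∀ t ∈ Ioi (0 : ℝ), 0 ≤ (-1 : ℝ) ^ n * iteratedDerivWithin n f (Ioi 0) t

/-- Complete monotonicity assumption: `K₀` is differentiable on `(0, ∞)` and `-K₀'` is a
completely monotone function that does not vanish identically on `(0, ∞)`. -/
def AssumptionA1 (K₀ : ℝ → ℝ) : Prop :=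
  DifferentiableOn ℝ K₀ (Ioi 0) ∧
    CompletelyMonotone (fun t => -deriv K₀ t) ∧
    ∃ t ∈ Ioi (0 : ℝ), deriv K₀ t ≠ 0

/-- Integrability assumption with exponent `α`:
`∫_0^1 |K₀(t)| t^{-α+α²} dt < ∞`. -/
def AssumptionA2 (K₀ : ℝ → ℝ) (α : ℝ) : Prop :=
  IntegrableOn (fun t : ℝ => |K₀ t| * t ^ (-α + α ^ 2)) (Ioo 0 1)

/-- Regularity assumption: `K₁` is of class `C^k` on `D × D` for some `k ≥ 4`. -/
def AssumptionA3 (D : Set ℂ) (K₁ : ℂ → ℂ → ℝ) : Prop :=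
  ∃ k : ℕ, 4 ≤ k ∧ ContDiffOn ℝ k (fun z : ℂ × ℂ => K₁ z.1 z.2) (D ×ˢ D)

/-- Symmetry assumption: on `D × D`, `K₁` is symmetric and invariant under reflection in the
real axis and under rotations. -/
def AssumptionA4 (D : Set ℂ) (K₁ : ℂ → ℂ → ℝ) : Prop :=
  ∀ x ∈ D, ∀ y ∈ D,
    K₁ x y = K₁ y x ∧
    K₁ (starRingEnd ℂ x) (starRingEnd ℂ y) = K₁ x y ∧
    ∀ θ : ℝ, K₁ (Complex.exp (θ * Complex.I) * x) (Complex.exp (θ * Complex.I) * y) = K₁ x y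

/-- A radial domain of the plane: open, connected (and nonempty), invariant under rotations
about the origin (for instance the plane, a disc, an annulus, the exterior of a disc). -/
def IsRadialDomain (D : Set ℂ) : Prop :=
  IsOpen D ∧ IsConnected D ∧ ∀ x ∈ D, ∀ θ : ℝ, Complex.exp (θ * Complex.I) * x ∈ D

/-- `λ_{n,b} = ∫_0^{2π} K₀(2b|sin(η/2)|) e^{inη} dη`. -/
def lambdaCoeff (K₀ : ℝ → ℝ) (n : ℕ) (b : ℝ) : ℂ :=
  ∫ η in (0 : ℝ)..(2 * Real.pi),
    (K₀ (2 * b * |Real.sin (η / 2)|) : ℂ) * Complex.exp (Complex.I * n * η)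

/-- `λ̃_{n,b} = ∫_0^{2π} K₀(|b - e^{iη}|) e^{inη} dη`. -/
def lambdaTildeCoeff (K₀ : ℝ → ℝ) (n : ℕ) (b : ℝ) : ℂ :=
  ∫ η in (0 : ℝ)..(2 * Real.pi),
    (K₀ ‖(b : ℂ) - Complex.exp (η * Complex.I)‖ : ℂ) * Complex.exp (Complex.I * n * η)

/-- `p_{n,b} = ∫_0^{2π} K₁(b, b e^{iη}) e^{inη} dη`. -/
def pCoeff (K₁ : ℂ → ℂ → ℝ) (n : ℕ) (b : ℝ) : ℂ :=
  ∫ η in (0 : ℝ)..(2 * Real.pi),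
    (K₁ b (b * Complex.exp (η * Complex.I)) : ℂ) * Complex.exp (Complex.I * n * η)

/-- `p̃_{n,b} = ∫_0^{2π} K₁(b, e^{iη}) e^{inη} dη`. -/
def pTildeCoeff (K₁ : ℂ → ℂ → ℝ) (n : ℕ) (b : ℝ) : ℂ :=
  ∫ η in (0 : ℝ)..(2 * Real.pi),
    (K₁ b (Complex.exp (η * Complex.I)) : ℂ) * Complex.exp (Complex.I * n * η)

end

/-! Both kernels have the form `K₀ (T √(1 - q cos² (η / 2)))`: `T = 2b`, `q = 1` gives `λ`, and `T =
1 + b`, `q = 4b / (1 + b)²` gives `λ̃`. Complete monotonicity of `-K₀'` makes every derivative of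
positive order of `y ↦ K₀ (T √(1 - y))` nonnegative on `[0, 1)`. By Bernstein's theorem this
function, up to its value at `0`, is a power series `∑ c k * y ^ k` with `c k ≥ 0`. Hence each
Fourier coefficient with `n ≥ 1` is `∑ c k * q ^ k * cosWeight k n`, where the weights are explicit
central-type binomial coefficients, nonnegative and decreasing in `n`.

Lower bounds: the linear function of slope `K₀'(T) < 0` can be subtracted from `K₀` without losing
the signs on `(0, T]`, and the coefficients of `|sin (η / 2)|` are explicit (`isCosWeightSum_sub`,
`le_cosCoeff`). Upper bound on `λ`: a decreasing sequence is at most its average, and averaging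
produces a Dirichlet-type kernel which is integrated against `K₀` using (A2)
(`nat_mul_cosCoeff_le`). Upper bound on the differences: `(λ n - λ (n + 1)) / (2n + 1)` is again
decreasing, so summing over a dyadic block suffices (`sub_succ_le`). For `λ̃`, positivity passes
from `q = 1` to smaller `q`, and decay for `q < 1` comes from `cosWeight k n = 0` for `k < n`. The
bounds on `p` and `p̃` are four integrations by parts. -/

/-! ### Bernstein's theorem on power series with nonnegative coefficients. -/

/-- The remainder of order `n` of the Taylor series at `0` of `G 0`, where `G j` stands for the
`j`-th derivative of `G 0`. -/
noncomputable def taylorRemainder (G : ℕ → ℝ → ℝ) (n : ℕ) (y : ℝ) : ℝ :=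
  G 0 y - ∑ k ∈ Finset.range n, G k 0 / (k.factorial : ℝ) * y ^ k

theorem taylorRemainder_succ_zero (G : ℕ → ℝ → ℝ) (n : ℕ) : taylorRemainder G (n + 1) 0 = 0 := by
  simp [taylorRemainder, Finset.sum_range_succ']

theorem hasDerivAt_taylorRemainder {G : ℕ → ℝ → ℝ} {y : ℝ} (h : HasDerivAt (G 0) (G 1 y) y)
    (n : ℕ) :
    HasDerivAt (taylorRemainder G (n + 1)) (taylorRemainder (fun j => G (j + 1)) n y) y := by
  unfold taylorRemainder
  refine h.sub ?_
  have h1 : ∀ k ∈ Finset.range (n + 1), HasDerivAt (fun y : ℝ => G k 0 / (k.factorial : ℝ) * y ^ k)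
      (G k 0 / (k.factorial : ℝ) * (k * y ^ (k - 1))) y := fun k _ =>
    (hasDerivAt_pow k y).const_mul _
  have h2 := HasDerivAt.fun_sum h1
  convert h2 using 1
  rw [Finset.sum_range_succ']
  simp only [Nat.cast_zero, zero_mul, mul_zero, add_zero]
  refine Finset.sum_congr rfl fun k _ => ?_
  rw [Nat.factorial_succ]
  push_cast
  have : (k.factorial : ℝ) ≠ 0 := by positivity
  have : (k + 1 : ℝ) ≠ 0 := by positivity
  field_simp

theorem monotoneOn_of_hasDerivAt_nonneg {g g' : ℝ → ℝ}
    (hg : ∀ y ∈ Ico (0 : ℝ) 1, HasDerivAt g (g' y) y) (hpos : ∀ y ∈ Ico (0 : ℝ) 1, 0 ≤ g' y) :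
    MonotoneOn g (Ico 0 1) := by
  refine monotoneOn_of_deriv_nonneg (convex_Ico 0 1)
    (fun y hy => (hg y hy).continuousAt.continuousWithinAt) (fun y hy => ?_) (fun y hy => ?_)
  · exact (hg y (interior_subset hy)).differentiableAt.differentiableWithinAt
  · rw [(hg y (interior_subset hy)).deriv]
    exact hpos y (interior_subset hy)

/-- The content is that `R_n(y) / y ^ n` increases. The difference of the two sides vanishes at `0`
when `n ≥ 1`, and its derivative is `l` times the same difference for the next lower order and the
shifted sequence. -/
theorem taylorRemainder_mul_le (n : ℕ) : ∀ {G : ℕ → ℝ → ℝ},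
    (∀ j, ∀ y ∈ Ico (0 : ℝ) 1, HasDerivAt (G j) (G (j + 1) y) y) →
    (∀ j, ∀ y ∈ Ico (0 : ℝ) 1, 0 ≤ G (j + 1) y) →
    ∀ y ∈ Ico (0 : ℝ) 1, ∀ l ∈ Icc (0 : ℝ) 1,
      taylorRemainder G n (l * y) ≤ l ^ n * taylorRemainder G n y := by
  have hmem : ∀ y ∈ Ico (0 : ℝ) 1, ∀ l ∈ Icc (0 : ℝ) 1, l * y ∈ Ico (0 : ℝ) 1 := by
    intro y hy l hl
    exact ⟨mul_nonneg hl.1 hy.1, lt_of_le_of_lt (mul_le_of_le_one_left hy.1 hl.2) hy.2⟩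
  induction n with
  | zero =>
    intro G hG hpos y hy l hl
    simp only [taylorRemainder, Finset.range_zero, Finset.sum_empty, sub_zero, pow_zero, one_mul]
    exact monotoneOn_of_hasDerivAt_nonneg (hG 0) (hpos 0) (hmem y hy l hl) hy
      (mul_le_of_le_one_left hy.1 hl.2)
  | succ n ih =>
    intro G hG hpos y hy l hl
    have hmono : MonotoneOn
        (fun z => l ^ (n + 1) * taylorRemainder G (n + 1) z - taylorRemainder G (n + 1) (l * z))
        (Ico 0 1) := by
      refine monotoneOn_of_hasDerivAt_nonneg
        (g' := fun z => l ^ (n + 1) * taylorRemainder (fun j => G (j + 1)) n z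
          - taylorRemainder (fun j => G (j + 1)) n (l * z) * l) (fun z hz => ?_) (fun z hz => ?_)
      · refine ((hasDerivAt_taylorRemainder (hG 0 z hz) n).const_mul _).sub ?_
        have h1 := hasDerivAt_taylorRemainder (hG 0 _ (hmem z hz l hl)) n
        have h2 : HasDerivAt (fun z : ℝ => l * z) l z := by
          simpa using (hasDerivAt_id z).const_mul l
        exact h1.comp z h2
      · have := ih (fun j => hG (j + 1)) (fun j => hpos (j + 1)) z hz l hl
        have h3 := mul_le_mul_of_nonneg_right this hl.1
        have h4 : l ^ (n + 1) * taylorRemainder (fun j => G (j + 1)) n z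
          = l ^ n * taylorRemainder (fun j => G (j + 1)) n z * l := by ring
        linarith
    have h := hmono ⟨le_rfl, one_pos⟩ hy hy.1
    simp only [mul_zero, taylorRemainder_succ_zero, sub_zero] at h
    linarith

theorem taylorRemainder_succ_nonneg (n : ℕ) : ∀ {G : ℕ → ℝ → ℝ},
    (∀ j, ∀ y ∈ Ico (0 : ℝ) 1, HasDerivAt (G j) (G (j + 1) y) y) →
    (∀ j, ∀ y ∈ Ico (0 : ℝ) 1, 0 ≤ G (j + 1) y) →
    ∀ y ∈ Ico (0 : ℝ) 1, 0 ≤ taylorRemainder G (n + 1) y := by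
  have key : ∀ (n : ℕ) {G : ℕ → ℝ → ℝ},
      (∀ j, ∀ y ∈ Ico (0 : ℝ) 1, HasDerivAt (G j) (G (j + 1) y) y) →
      (∀ y ∈ Ico (0 : ℝ) 1, 0 ≤ taylorRemainder (fun j => G (j + 1)) n y) →
      ∀ y ∈ Ico (0 : ℝ) 1, 0 ≤ taylorRemainder G (n + 1) y := by
    intro n G hG hpos y hy
    have h := monotoneOn_of_hasDerivAt_nonneg
      (fun z hz => hasDerivAt_taylorRemainder (hG 0 z hz) n) hpos ⟨le_rfl, one_pos⟩ hy hy.1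
    rwa [taylorRemainder_succ_zero] at h
  induction n with
  | zero =>
    intro G hG hpos
    exact key 0 hG (by simpa [taylorRemainder] using hpos 0)
  | succ n ih =>
    intro G hG hpos
    exact key (n + 1) hG (ih (fun j => hG (j + 1)) (fun j => hpos (j + 1)))

/-- Bernstein's theorem: a function on `[0, 1)` whose derivatives of positive order are
nonnegative is the sum of its Taylor series at `0`. -/
theorem hasSum_taylor_of_deriv_nonneg {G : ℕ → ℝ → ℝ}
    (hG : ∀ j, ∀ y ∈ Ico (0 : ℝ) 1, HasDerivAt (G j) (G (j + 1) y) y)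
    (hpos : ∀ j, ∀ y ∈ Ico (0 : ℝ) 1, 0 ≤ G (j + 1) y) (h0 : G 0 0 = 0) {y : ℝ}
    (hy : y ∈ Ico (0 : ℝ) 1) :
    HasSum (fun k => G k 0 / (k.factorial : ℝ) * y ^ k) (G 0 y) := by
  have hcoef : ∀ k, 0 ≤ G k 0 / (k.factorial : ℝ) := by
    rintro (_ | k)
    · simp [h0]
    · exact div_nonneg (hpos k 0 ⟨le_rfl, one_pos⟩) (by positivity)
  rw [hasSum_iff_tendsto_nat_of_nonneg fun k => mul_nonneg (hcoef k) (pow_nonneg hy.1 k)]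
  -- Any point of `(y, 1)` would do: the remainder at `y` is at most `(y / z) ^ n * G 0 z`, which
  -- decays geometrically.
  set z : ℝ := (y + 1) / 2 with hz
  have hz0 : 0 < z := by have := hy.1; positivity
  have hyz : y < z := by have := hy.2; rw [hz]; linarith
  have hz1 : z < 1 := by have := hy.2; rw [hz]; linarith
  set l : ℝ := y / z with hl
  have hl0 : 0 ≤ l := div_nonneg hy.1 hz0.le
  have hl1 : l < 1 := (div_lt_one hz0).2 hyz
  have hlz : l * z = y := div_mul_cancel₀ _ hz0.ne'
  have hrem : Filter.Tendsto (fun n => taylorRemainder G (n + 1) y) Filter.atTop (nhds 0) := by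
    have hlim : Filter.Tendsto (fun n => l ^ (n + 1) * G 0 z) Filter.atTop (nhds 0) := by
      simpa using ((tendsto_pow_atTop_nhds_zero_of_lt_one hl0 hl1).comp
        (Filter.tendsto_add_atTop_nat 1)).mul_const (G 0 z)
    refine squeeze_zero (fun n => taylorRemainder_succ_nonneg n hG hpos y hy) (fun n => ?_) hlim
    have h1 := taylorRemainder_mul_le (n + 1) hG hpos z ⟨hz0.le, hz1⟩ l ⟨hl0, hl1.le⟩
    rw [hlz] at h1
    refine h1.trans (mul_le_mul_of_nonneg_left ?_ (pow_nonneg hl0 _))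
    exact sub_le_self _ (Finset.sum_nonneg fun k _ => mul_nonneg (hcoef k) (pow_nonneg hz0.le k))
  have h2 : Filter.Tendsto (fun n => taylorRemainder G n y) Filter.atTop (nhds 0) :=
    (Filter.tendsto_add_atTop_iff_nat 1).1 hrem
  have h3 := h2.const_sub (G 0 y)
  simpa [taylorRemainder] using h3

/-! ### Absolute monotonicity after the substitution `t = T √(1 - y)`. -/

/-- The convex cone generated by the functions `y ↦ F j (T √(1 - y)) (1 - y)^{-m/2}`. -/
inductive SqrtCone (F : ℕ → ℝ → ℝ) (T : ℝ) : (ℝ → ℝ) → Prop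
  | base (j m : ℕ) : SqrtCone F T fun y => F j (T * √(1 - y)) * (√(1 - y))⁻¹ ^ m
  | add {g h : ℝ → ℝ} (hg : SqrtCone F T g) (hh : SqrtCone F T h) :
      SqrtCone F T fun y => g y + h y
  | smul {g : ℝ → ℝ} {c : ℝ} (hc : 0 ≤ c) (hg : SqrtCone F T g) : SqrtCone F T fun y => c * g y

theorem SqrtCone.nonneg {F : ℕ → ℝ → ℝ} {T : ℝ} (hT : 0 < T)
    (hF : ∀ j, ∀ t ∈ Ioc 0 T, 0 ≤ F j t) {g : ℝ → ℝ} (hg : SqrtCone F T g) :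
    ∀ y ∈ Ico (0 : ℝ) 1, 0 ≤ g y := by
  induction hg with
  | base j m =>
    intro y hy
    have hs : 0 < √(1 - y) := Real.sqrt_pos.2 (by linarith [hy.2])
    have hs1 : √(1 - y) ≤ 1 := Real.sqrt_le_one.2 (by linarith [hy.1])
    exact mul_nonneg (hF j _ ⟨by positivity, mul_le_of_le_one_right hT.le hs1⟩) (by positivity)
  | add _ _ ihg ihh => exact fun y hy => add_nonneg (ihg y hy) (ihh y hy)
  | smul hc _ ih => exact fun y hy => mul_nonneg hc (ih y hy)

theorem hasDerivAt_sqrt_one_sub {y : ℝ} (hy : y < 1) :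
    HasDerivAt (fun y : ℝ => √(1 - y)) (-(√(1 - y))⁻¹ / 2) y := by
  have h : HasDerivAt (fun y : ℝ => 1 - y) (-1) y := by
    simpa using (hasDerivAt_id y).const_sub 1
  convert h.sqrt (by linarith) using 1
  rw [div_eq_div_iff (by norm_num)
    (by have := Real.sqrt_pos.2 (show 0 < 1 - y by linarith); positivity)]
  have := Real.sqrt_pos.2 (show 0 < 1 - y by linarith)
  field_simp

theorem hasDerivAt_comp_sqrt {K : ℝ → ℝ} {k T y : ℝ} (hy : y < 1)
    (hK : HasDerivAt K k (T * √(1 - y))) :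
    HasDerivAt (fun y => K (T * √(1 - y))) (-(k * (T / 2) * (√(1 - y))⁻¹)) y := by
  have h := hK.comp y ((hasDerivAt_sqrt_one_sub hy).const_mul T)
  refine h.congr_deriv ?_
  ring

/-- With `s = √(1 - y)` one has `s' = -1 / (2s)`. This sign cancels those from `F j' = -F (j + 1)`
and from the negative powers of `s`, so differentiation preserves the cone. -/
theorem SqrtCone.exists_hasDerivAt {F : ℕ → ℝ → ℝ} {T : ℝ} (hT : 0 < T)
    (hF : ∀ j, ∀ t, 0 < t → HasDerivAt (F j) (-F (j + 1) t) t) {g : ℝ → ℝ}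
    (hg : SqrtCone F T g) :
    ∃ g', SqrtCone F T g' ∧ ∀ y ∈ Ico (0 : ℝ) 1, HasDerivAt g (g' y) y := by
  induction hg with
  | base j m =>
    refine ⟨_, ((SqrtCone.base (j + 1) (m + 1)).smul (c := T / 2) (by positivity)).add
      ((SqrtCone.base j (m + 2)).smul (c := m / 2) (by positivity)), fun y hy => ?_⟩
    have hs : 0 < √(1 - y) := Real.sqrt_pos.2 (by linarith [hy.2])
    have h1 := hasDerivAt_comp_sqrt hy.2 (hF j (T * √(1 - y)) (by positivity))
    have h2 := ((hasDerivAt_sqrt_one_sub hy.2).fun_inv hs.ne').fun_pow m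
    refine (h1.mul h2).congr_deriv ?_
    rcases m with _ | m
    · simp; ring
    · simp only [Nat.add_sub_cancel]
      push_cast
      ring
  | add _ _ ihg ihh =>
    obtain ⟨g', hg', h1⟩ := ihg
    obtain ⟨h', hh', h2⟩ := ihh
    exact ⟨_, hg'.add hh', fun y hy => (h1 y hy).add (h2 y hy)⟩
  | smul hc _ ih =>
    obtain ⟨g', hg', h1⟩ := ih
    exact ⟨_, hg'.smul hc, fun y hy => (h1 y hy).const_mul _⟩

/-- If `K` has derivatives of alternating signs on `(0, T]`, then `K (T √(1 - y)) - K T` is a power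
series in `y ∈ [0, 1)` with nonnegative coefficients. -/
theorem exists_hasSum_comp_sqrt {F : ℕ → ℝ → ℝ} {T : ℝ} (hT : 0 < T)
    (hF : ∀ j, ∀ t, 0 < t → HasDerivAt (F j) (-F (j + 1) t) t)
    (hpos : ∀ j, ∀ t ∈ Ioc 0 T, 0 ≤ F (j + 1) t) :
    ∃ c : ℕ → ℝ, (∀ k, 0 ≤ c k) ∧
      ∀ y ∈ Ico (0 : ℝ) 1, HasSum (fun k => c k * y ^ k) (F 0 (T * √(1 - y)) - F 0 T) := by
  have hnext : ∀ g : {g // SqrtCone (fun j => F (j + 1)) T g},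
      ∃ g' : {g // SqrtCone (fun j => F (j + 1)) T g},
        ∀ y ∈ Ico (0 : ℝ) 1, HasDerivAt g.1 (g'.1 y) y := by
    intro g
    obtain ⟨g', h1, h2⟩ := g.2.exists_hasDerivAt hT fun j => hF (j + 1)
    exact ⟨⟨g', h1⟩, h2⟩
  choose next hnext using hnext
  let H : ℕ → {g // SqrtCone (fun j => F (j + 1)) T g} := fun n =>
    next^[n] ⟨_, (SqrtCone.base 0 1).smul (c := T / 2) (by positivity)⟩
  -- The cone is entered only at the first derivative, built from `F 1`, so no sign of `F 0` is
  -- needed.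
  let G : ℕ → ℝ → ℝ := fun n => Nat.casesOn n (fun y => F 0 (T * √(1 - y)) - F 0 T)
    fun n => (H n).1
  have hG : ∀ j, ∀ y ∈ Ico (0 : ℝ) 1, HasDerivAt (G j) (G (j + 1) y) y := by
    rintro (_ | j) y hy
    · have hs : 0 < √(1 - y) := Real.sqrt_pos.2 (by linarith [hy.2])
      have h1 := (hasDerivAt_comp_sqrt hy.2 (hF 0 (T * √(1 - y)) (by positivity))).sub_const
        (F 0 T)
      refine h1.congr_deriv ?_
      change _ = T / 2 * (F (0 + 1) (T * √(1 - y)) * (√(1 - y))⁻¹ ^ 1)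
      ring
    · change HasDerivAt (H j).1 ((H (j + 1)).1 y) y
      have : H (j + 1) = next (H j) := Function.iterate_succ_apply' next j _
      rw [this]
      exact hnext (H j) y hy
  have hGpos : ∀ j, ∀ y ∈ Ico (0 : ℝ) 1, 0 ≤ G (j + 1) y := fun j => (H j).2.nonneg hT hpos
  have hG0 : G 0 0 = 0 := by simp [G]
  refine ⟨fun k => G k 0 / (k.factorial : ℝ), ?_, fun y hy =>
    hasSum_taylor_of_deriv_nonneg hG hGpos hG0 hy⟩
  rintro (_ | k)
  · simp [hG0]
  · exact div_nonneg (hGpos k 0 ⟨le_rfl, one_pos⟩) (by positivity)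

theorem CompletelyMonotone.exists_derivSeq {f : ℝ → ℝ} (hf : CompletelyMonotone f) :
    ∃ F : ℕ → ℝ → ℝ, F 0 = f ∧ (∀ j, ∀ t, 0 < t → HasDerivAt (F j) (-F (j + 1) t) t) ∧
      ∀ j, ∀ t, 0 < t → 0 ≤ F j t := by
  refine ⟨fun j t => (-1) ^ j * iteratedDerivWithin j f (Ioi 0) t, ?_, fun j t ht => ?_,
    fun j t ht => hf.2 j t ht⟩
  · ext t; simp
  · have hd := (hf.1.differentiableOn_iteratedDerivWithin (m := j)
      (by exact_mod_cast WithTop.coe_lt_top _) (uniqueDiffOn_Ioi 0) t ht).differentiableAt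
      (Ioi_mem_nhds ht)
    have h1 := hd.hasDerivAt.const_mul ((-1 : ℝ) ^ j)
    refine h1.congr_deriv ?_
    beta_reduce
    rw [iteratedDerivWithin_succ, derivWithin_of_isOpen isOpen_Ioi ht, pow_succ]
    ring

/-! ### Fourier coefficients of the powers of `cos² (η / 2)`. -/

/-- The `n`-th cosine coefficient of `cos (η / 2) ^ (2 * k)` on `[0, 2π]`. -/
noncomputable def cosWeight (k n : ℕ) : ℝ := 2 * Real.pi * (2 * k).choose (k + n) / 4 ^ k

theorem integral_exp_int_mul (j : ℤ) :
    ∫ η in (0 : ℝ)..(2 * Real.pi), Complex.exp (Complex.I * j * η)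
      = if j = 0 then (2 * Real.pi : ℂ) else 0 := by
  split_ifs with h
  · simp [h]
  · have hj : Complex.I * j ≠ 0 := mul_ne_zero Complex.I_ne_zero (by exact_mod_cast h)
    rw [integral_exp_mul_complex hj]
    have : Complex.I * j * ((2 * Real.pi : ℝ) : ℂ) = j * (2 * Real.pi * Complex.I) := by
      push_cast; ring
    rw [this, Complex.exp_int_mul_two_pi_mul_I]
    simp

theorem cos_sq_pow_mul_exp (k n : ℕ) (η : ℝ) :
    (((Real.cos (η / 2) ^ 2) ^ k : ℝ) : ℂ) * Complex.exp (Complex.I * n * η)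
      = ∑ m ∈ Finset.range (2 * k + 1), ((2 * k).choose m / 4 ^ k : ℂ)
          * Complex.exp (Complex.I * ((k + n - m : ℤ) : ℂ) * η) := by
  have h1 : (((Real.cos (η / 2) ^ 2) ^ k : ℝ) : ℂ)
      = (Complex.exp (-(η / 2) * Complex.I) + Complex.exp (η / 2 * Complex.I)) ^ (2 * k)
        / 4 ^ k := by
    push_cast
    rw [Complex.cos, ← pow_mul, div_pow, pow_mul (2 : ℂ)]
    norm_num
    rw [add_comm]
  rw [h1, add_pow, Finset.sum_div, Finset.sum_mul]
  refine Finset.sum_congr rfl fun m hm => ?_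
  have hm' : m ≤ 2 * k := Nat.lt_succ_iff.1 (Finset.mem_range.1 hm)
  rw [← Complex.exp_nat_mul, ← Complex.exp_nat_mul]
  have h2 : Complex.exp (Complex.I * ((k + n - m : ℤ) : ℂ) * η)
      = Complex.exp (m * (-(η / 2) * Complex.I))
        * Complex.exp ((2 * k - m : ℕ) * (η / 2 * Complex.I))
        * Complex.exp (Complex.I * n * η) := by
    rw [← Complex.exp_add, ← Complex.exp_add]
    congr 1
    push_cast [Nat.cast_sub hm']
    ring
  rw [h2]
  ring

theorem integral_cos_sq_pow_mul_exp (k n : ℕ) :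
    ∫ η in (0 : ℝ)..(2 * Real.pi),
      (((Real.cos (η / 2) ^ 2) ^ k : ℝ) : ℂ) * Complex.exp (Complex.I * n * η)
      = (cosWeight k n : ℂ) := by
  simp_rw [cos_sq_pow_mul_exp]
  rw [intervalIntegral.integral_finsetSum fun m _ =>
    (Continuous.intervalIntegrable (by fun_prop) _ _)]
  simp_rw [intervalIntegral.integral_const_mul, integral_exp_int_mul]
  unfold cosWeight
  by_cases h : k + n ∈ Finset.range (2 * k + 1)
  · rw [Finset.sum_eq_single_of_mem _ h]
    · rw [if_pos (by push_cast; ring)]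
      push_cast
      ring
    · intro m _ hm
      rw [if_neg (by omega), mul_zero]
  · rw [Finset.sum_eq_zero]
    · rw [Nat.choose_eq_zero_of_lt (by simpa [Nat.lt_succ_iff] using h)]
      simp
    · intro m hm
      rw [if_neg, mul_zero]
      rw [Finset.mem_range] at h hm
      omega

/-- The `n`-th cosine coefficient of `Φ` on `[0, 2π]`. -/
noncomputable def cosCoeff (Φ : ℝ → ℝ) (n : ℕ) : ℝ :=
  ∫ η in (0 : ℝ)..(2 * Real.pi), Φ η * Real.cos (n * η)

/-- The symmetry `η ↦ 2π - η` kills the sine part. -/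
theorem integral_mul_exp_eq_cosCoeff {Φ : ℝ → ℝ}
    (hΦ : IntervalIntegrable Φ volume 0 (2 * Real.pi))
    (hsymm : ∀ η, Φ (2 * Real.pi - η) = Φ η) (n : ℕ) :
    ∫ η in (0 : ℝ)..(2 * Real.pi), (Φ η : ℂ) * Complex.exp (Complex.I * n * η)
      = (cosCoeff Φ n : ℂ) := by
  have hc : IntervalIntegrable (fun η => Φ η * Real.cos (n * η)) volume 0 (2 * Real.pi) :=
    hΦ.mul_continuousOn (by fun_prop)
  have hs : IntervalIntegrable (fun η => Φ η * Real.sin (n * η)) volume 0 (2 * Real.pi) :=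
    hΦ.mul_continuousOn (by fun_prop)
  have hpt : ∀ η : ℝ, (Φ η : ℂ) * Complex.exp (Complex.I * n * η)
      = ((Φ η * Real.cos (n * η) : ℝ) : ℂ) + ((Φ η * Real.sin (n * η) : ℝ) : ℂ) * Complex.I := by
    intro η
    have : Complex.I * n * η = ((n * η : ℝ) : ℂ) * Complex.I := by push_cast; ring
    rw [this, Complex.exp_mul_I]
    push_cast
    ring
  have hsin : ∫ η in (0 : ℝ)..(2 * Real.pi), Φ η * Real.sin (n * η) = 0 := by
    have h := intervalIntegral.integral_comp_sub_left (a := 0) (b := 2 * Real.pi)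
      (fun η => Φ η * Real.sin (n * η)) (2 * Real.pi)
    have h2 : ∀ η : ℝ, Φ (2 * Real.pi - η) * Real.sin (n * (2 * Real.pi - η))
        = -(Φ η * Real.sin (n * η)) := by
      intro η
      rw [hsymm, mul_sub, Real.sin_nat_mul_two_pi_sub]
      ring
    simp only [h2, sub_self, sub_zero, intervalIntegral.integral_neg] at h
    linarith
  simp_rw [hpt]
  have hc' : IntervalIntegrable (fun η => ((Φ η * Real.cos (n * η) : ℝ) : ℂ)) volume 0
      (2 * Real.pi) := ⟨hc.1.ofReal, hc.2.ofReal⟩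
  have hs' : IntervalIntegrable (fun η => ((Φ η * Real.sin (n * η) : ℝ) : ℂ)) volume 0
      (2 * Real.pi) := ⟨hs.1.ofReal, hs.2.ofReal⟩
  rw [intervalIntegral.integral_add hc' (hs'.mul_const _),
    intervalIntegral.integral_mul_const, intervalIntegral.integral_ofReal,
    intervalIntegral.integral_ofReal, hsin]
  simp [cosCoeff]

theorem cosCoeff_cos_sq_pow (k n : ℕ) :
    cosCoeff (fun η => (Real.cos (η / 2) ^ 2) ^ k) n = cosWeight k n := by
  have h := integral_mul_exp_eq_cosCoeff (Φ := fun η => (Real.cos (η / 2) ^ 2) ^ k)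
    (Continuous.intervalIntegrable (by fun_prop) _ _)
    (fun η => by
      have : (2 * Real.pi - η) / 2 = Real.pi - η / 2 := by ring
      simp only [this, Real.cos_pi_sub, neg_sq]) n
  rw [integral_cos_sq_pow_mul_exp] at h
  exact_mod_cast h.symm

theorem cosWeight_nonneg (k n : ℕ) : 0 ≤ cosWeight k n := by
  have := Real.pi_pos
  unfold cosWeight
  positivity

theorem cosWeight_eq_zero {k n : ℕ} (h : k < n) : cosWeight k n = 0 := by
  simp [cosWeight, Nat.choose_eq_zero_of_lt (show 2 * k < k + n by omega)]

theorem cosWeight_le (k n : ℕ) : cosWeight k n ≤ 2 * Real.pi := by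
  unfold cosWeight
  rw [mul_div_assoc]
  refine mul_le_of_le_one_right Real.two_pi_pos.le ((div_le_one (by positivity)).2 ?_)
  have := Nat.choose_le_two_pow (2 * k) (k + n)
  rw [pow_mul] at this
  exact_mod_cast this

/-- Consecutive binomials have ratio `(k - n) / (k + n + 1)`. The factor `2n + 1` does not depend on
`k`, so it can be pulled out of the sums over `k`. -/
theorem cosWeight_sub_succ (k n : ℕ) :
    cosWeight k n - cosWeight k (n + 1) = cosWeight k n * ((2 * n + 1) / (k + n + 1)) := by
  have hc : ((2 * k).choose (k + n + 1) : ℝ) * (k + n + 1)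
      = (2 * k).choose (k + n) * (k - n) := by
    by_cases h : n ≤ k
    · have := Nat.choose_succ_right_eq (2 * k) (k + n)
      rw [show 2 * k - (k + n) = k - n by omega] at this
      rw [← Nat.cast_sub h]
      exact_mod_cast this
    · rw [Nat.choose_eq_zero_of_lt (show 2 * k < k + n by omega),
        Nat.choose_eq_zero_of_lt (show 2 * k < k + n + 1 by omega)]
      simp
  have hk : (k + n + 1 : ℝ) ≠ 0 := by positivity
  have hc' : ((2 * k).choose (k + n + 1) : ℝ) = (2 * k).choose (k + n) * (k - n) / (k + n + 1) := by
    rw [eq_div_iff hk, hc]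
  unfold cosWeight
  rw [← add_assoc, hc']
  field_simp
  ring

theorem cosWeight_succ_le (k n : ℕ) : cosWeight k (n + 1) ≤ cosWeight k n := by
  rw [← sub_nonneg, cosWeight_sub_succ]
  have := cosWeight_nonneg k n
  positivity

/-! ### Monotonicity of nonnegative combinations of the weights. -/

/-- Sequences `L n = ∑ k, a k * cosWeight k n`, `n ≥ 1`, with nonnegative coefficients `a`. -/
def IsCosWeightSum (a L : ℕ → ℝ) : Prop :=
  (∀ k, 0 ≤ a k) ∧ ∀ n, 1 ≤ n → HasSum (fun k => a k * cosWeight k n) (L n)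

theorem IsCosWeightSum.nonneg {a L : ℕ → ℝ} (h : IsCosWeightSum a L) {n : ℕ} (hn : 1 ≤ n) :
    0 ≤ L n :=
  (h.2 n hn).nonneg fun k => mul_nonneg (h.1 k) (cosWeight_nonneg k n)

theorem IsCosWeightSum.succ_le {a L : ℕ → ℝ} (h : IsCosWeightSum a L) {n : ℕ} (hn : 1 ≤ n) :
    L (n + 1) ≤ L n :=
  hasSum_le (fun k => mul_le_mul_of_nonneg_left (cosWeight_succ_le k n) (h.1 k))
    (h.2 (n + 1) (by omega)) (h.2 n hn)

theorem IsCosWeightSum.anti {a L : ℕ → ℝ} (h : IsCosWeightSum a L) {m n : ℕ} (hm : 1 ≤ m)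
    (hmn : m ≤ n) : L n ≤ L m := by
  induction n, hmn using Nat.le_induction with
  | base => exact le_rfl
  | succ n hn ih => exact (h.succ_le (hm.trans hn)).trans ih

theorem IsCosWeightSum.hasSum_sub_div {a L : ℕ → ℝ} (h : IsCosWeightSum a L) {n : ℕ}
    (hn : 1 ≤ n) :
    HasSum (fun k => a k * (cosWeight k n / (k + n + 1)))
      ((L n - L (n + 1)) / (2 * n + 1)) := by
  refine (((h.2 n hn).sub (h.2 (n + 1) (by omega))).div_const (2 * n + 1 : ℝ)).congr_fun ?_
  intro k
  have : (2 * n + 1 : ℝ) ≠ 0 := by positivity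
  rw [← mul_sub, cosWeight_sub_succ]
  field_simp

/-- After division by `2n + 1` the weights are `cosWeight k n / (k + n + 1)`, whose numerator
decreases and whose denominator increases with `n`. This replaces convexity of `L`. -/
theorem IsCosWeightSum.sub_div_anti {a L : ℕ → ℝ} (h : IsCosWeightSum a L) {m n : ℕ}
    (hm : 1 ≤ m) (hmn : m ≤ n) :
    (L n - L (n + 1)) / (2 * n + 1) ≤ (L m - L (m + 1)) / (2 * m + 1) := by
  have key : ∀ n, 1 ≤ n → (L (n + 1) - L (n + 1 + 1)) / (2 * (n + 1 : ℕ) + 1)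
      ≤ (L n - L (n + 1)) / (2 * n + 1) := by
    intro n hn
    refine hasSum_le (fun k => mul_le_mul_of_nonneg_left ?_ (h.1 k))
      (h.hasSum_sub_div (by omega)) (h.hasSum_sub_div hn)
    have := cosWeight_succ_le k n
    have := cosWeight_nonneg k n
    gcongr
    linarith
  induction n, hmn using Nat.le_induction with
  | base => exact le_rfl
  | succ n hn ih => exact (key n (hm.trans hn)).trans ih

/-! ### Coefficients of a profile as sums of weights. -/

theorem integral_cos_nat_mul {n : ℕ} (hn : 1 ≤ n) :
    ∫ η in (0 : ℝ)..(2 * Real.pi), Real.cos (n * η) = 0 := by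
  have h := cosCoeff_cos_sq_pow 0 n
  rw [cosWeight_eq_zero (by omega)] at h
  simpa [cosCoeff] using h

/-- The function `η ↦ K (T √(1 - q cos² (η / 2)))`. -/
noncomputable def profile (K : ℝ → ℝ) (T q η : ℝ) : ℝ :=
  K (T * √(1 - q * Real.cos (η / 2) ^ 2))

theorem profile_two_pi_sub (K : ℝ → ℝ) (T q η : ℝ) :
    profile K T q (2 * Real.pi - η) = profile K T q η := by
  have : (2 * Real.pi - η) / 2 = Real.pi - η / 2 := by ring
  simp only [profile, this, Real.cos_pi_sub, neg_sq]

theorem mul_cos_sq_mem_Ico {q η : ℝ} (hq : q ∈ Ioc (0 : ℝ) 1) (hη : η ∈ Ioo 0 (2 * Real.pi)) :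
    q * Real.cos (η / 2) ^ 2 ∈ Ico (0 : ℝ) 1 := by
  have hs : 0 < Real.sin (η / 2) := Real.sin_pos_of_pos_of_lt_pi (by linarith [hη.1])
    (by linarith [hη.2])
  have h1 : Real.cos (η / 2) ^ 2 < 1 := by
    have := Real.sin_sq_add_cos_sq (η / 2)
    nlinarith
  exact ⟨mul_nonneg hq.1.le (sq_nonneg _),
    lt_of_le_of_lt (mul_le_of_le_one_left (sq_nonneg _) hq.2) h1⟩

theorem ae_mem_Ioo_of_mem_uIoc {a b : ℝ} (hab : a ≤ b) :
    ∀ᵐ x : ℝ, x ∈ uIoc a b → x ∈ Ioo a b := by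
  have h : ∀ᵐ x : ℝ, x ≠ b := by simp [ae_iff]
  filter_upwards [h] with x hx hxm
  rw [uIoc_of_le hab] at hxm
  exact ⟨hxm.1, lt_of_le_of_ne hxm.2 hx⟩

/-- The series is integrated termwise, dominated by itself with the cosine dropped, whose sum is
integrable. The constant `K T` disappears because `n ≥ 1`. -/
theorem isCosWeightSum_cosCoeff_profile {K : ℝ → ℝ} {T q : ℝ} {c : ℕ → ℝ} (hc : ∀ k, 0 ≤ c k)
    (hK : ∀ y ∈ Ico (0 : ℝ) 1, HasSum (fun k => c k * y ^ k) (K (T * √(1 - y)) - K T))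
    (hq : q ∈ Ioc (0 : ℝ) 1)
    (hint : IntervalIntegrable (profile K T q) volume 0 (2 * Real.pi)) :
    IsCosWeightSum (fun k => c k * q ^ k) (cosCoeff (profile K T q)) := by
  refine ⟨fun k => mul_nonneg (hc k) (pow_nonneg hq.1.le k), fun n hn => ?_⟩
  have hae := ae_mem_Ioo_of_mem_uIoc Real.two_pi_pos.le
  have hsum : ∀ η ∈ Ioo 0 (2 * Real.pi),
      HasSum (fun k => c k * (q * Real.cos (η / 2) ^ 2) ^ k) (profile K T q η - K T) :=
    fun η hη => hK _ (mul_cos_sq_mem_Ico hq hη)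
  have h := intervalIntegral.hasSum_integral_of_dominated_convergence (μ := volume)
    (a := 0) (b := 2 * Real.pi)
    (F := fun k η => c k * (q * Real.cos (η / 2) ^ 2) ^ k * Real.cos (n * η))
    (f := fun η => (profile K T q η - K T) * Real.cos (n * η))
    (fun k η => c k * (q * Real.cos (η / 2) ^ 2) ^ k)
    (fun k => Continuous.aestronglyMeasurable (by fun_prop))
    (fun k => Filter.Eventually.of_forall fun η _ => ?_)
    (by filter_upwards [hae] with η h1 h2 using (hsum η (h1 h2)).summable)
    ?_
    (by filter_upwards [hae] with η h1 h2 using (hsum η (h1 h2)).mul_right _)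
  · have e1 : ∀ k, ∫ η in (0 : ℝ)..(2 * Real.pi),
        c k * (q * Real.cos (η / 2) ^ 2) ^ k * Real.cos (n * η) = c k * q ^ k * cosWeight k n := by
      intro k
      rw [← cosCoeff_cos_sq_pow, cosCoeff, ← intervalIntegral.integral_const_mul]
      congr 1
      ext η
      rw [mul_pow]
      ring
    have e2 : ∫ η in (0 : ℝ)..(2 * Real.pi), (profile K T q η - K T) * Real.cos (n * η)
        = cosCoeff (profile K T q) n := by
      simp_rw [sub_mul]
      rw [intervalIntegral.integral_sub (hint.mul_continuousOn (by fun_prop))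
        (Continuous.intervalIntegrable (by fun_prop) _ _), intervalIntegral.integral_const_mul,
        integral_cos_nat_mul hn, mul_zero, sub_zero, cosCoeff]
    simpa only [e1, e2] using h
  · rw [norm_mul, Real.norm_eq_abs, Real.norm_eq_abs, abs_of_nonneg
      (mul_nonneg (hc k) (pow_nonneg (mul_nonneg hq.1.le (sq_nonneg _)) k))]
    exact mul_le_of_le_one_right
      (mul_nonneg (hc k) (pow_nonneg (mul_nonneg hq.1.le (sq_nonneg _)) k)) (Real.abs_cos_le_one _)
  · have h1 : IntervalIntegrable (fun η => profile K T q η - K T) volume 0 (2 * Real.pi) :=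
      hint.sub (Continuous.intervalIntegrable (by fun_prop) _ _)
    refine h1.congr_ae ?_
    refine (ae_restrict_iff' measurableSet_uIoc).2 ?_
    filter_upwards [hae] with η h1 h2 using (hsum η (h1 h2)).tsum_eq.symm

/-! ### Consequences of complete monotonicity for the kernel. -/

theorem AssumptionA1.hasDerivAt {K : ℝ → ℝ} (h : AssumptionA1 K) {t : ℝ} (ht : 0 < t) :
    HasDerivAt K (deriv K t) t :=
  ((h.1 t ht).differentiableAt (Ioi_mem_nhds ht)).hasDerivAt

theorem AssumptionA1.deriv_nonpos {K : ℝ → ℝ} (h : AssumptionA1 K) {t : ℝ} (ht : 0 < t) :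
    deriv K t ≤ 0 := by
  obtain ⟨F, h0, -, h2⟩ := h.2.1.exists_derivSeq
  have := h2 0 t ht
  rw [h0] at this
  linarith

theorem antitoneOn_Ioi_of_hasDerivAt {g g' : ℝ → ℝ} (h : ∀ t, 0 < t → HasDerivAt g (g' t) t)
    (h' : ∀ t, 0 < t → g' t ≤ 0) : AntitoneOn g (Ioi 0) := by
  refine antitoneOn_of_deriv_nonpos (convex_Ioi 0)
    (fun t ht => (h t ht).continuousAt.continuousWithinAt)
    (fun t ht => (h t (interior_subset ht)).differentiableAt.differentiableWithinAt)
    (fun t ht => ?_)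
  rw [(h t (interior_subset ht)).deriv]
  exact h' t (interior_subset ht)

theorem AssumptionA1.antitoneOn {K : ℝ → ℝ} (h : AssumptionA1 K) : AntitoneOn K (Ioi 0) :=
  antitoneOn_Ioi_of_hasDerivAt (fun _ ht => h.hasDerivAt ht) fun _ ht => h.deriv_nonpos ht

theorem AssumptionA1.continuousOn {K : ℝ → ℝ} (h : AssumptionA1 K) : ContinuousOn K (Ioi 0) :=
  h.1.continuousOn

theorem AssumptionA1.monotoneOn_deriv {K : ℝ → ℝ} (h : AssumptionA1 K) :
    MonotoneOn (deriv K) (Ioi 0) := by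
  obtain ⟨F, h0, h1, h2⟩ := h.2.1.exists_derivSeq
  have := antitoneOn_Ioi_of_hasDerivAt (h1 0) fun t ht => neg_nonpos.2 (h2 1 t ht)
  rw [h0] at this
  intro s hs t ht hst
  have := this hs ht hst
  simp only at this
  linarith

/-- Since `-K'` decreases, `-K' - a ≥ 0` on `(0, T]`, and higher derivatives do not see the linear
term. The value `a = 0` gives `K` itself; `a = -K'(T)` gives the lower bounds. -/
theorem AssumptionA1.exists_hasSum {K : ℝ → ℝ} (h : AssumptionA1 K) {T a : ℝ} (hT : 0 < T)
    (ha : a ≤ -deriv K T) :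
    ∃ c : ℕ → ℝ, (∀ k, 0 ≤ c k) ∧ ∀ y ∈ Ico (0 : ℝ) 1, HasSum (fun k => c k * y ^ k)
      ((K (T * √(1 - y)) + a * (T * √(1 - y))) - (K T + a * T)) := by
  obtain ⟨F, h0, h1, h2⟩ := h.2.1.exists_derivSeq
  let H : ℕ → ℝ → ℝ := fun j => Nat.casesOn j (fun t => K t + a * t)
    fun j => Nat.casesOn j (fun t => F 0 t - a) fun j => F (j + 1)
  refine exists_hasSum_comp_sqrt (F := H) hT ?_ ?_
  · rintro (_ | _ | j) t ht
    · have h3 := (h.hasDerivAt ht).add ((hasDerivAt_id t).const_mul a)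
      refine h3.congr_deriv ?_
      change _ = -(F 0 t - a)
      rw [h0]
      ring
    · exact (h1 0 t ht).sub_const a
    · exact h1 (j + 1) t ht
  · rintro (_ | j) t ht
    · change 0 ≤ F 0 t - a
      rw [h0]
      have := h.monotoneOn_deriv ht.1 hT ht.2
      simp only
      linarith
    · exact h2 (j + 1) t ht.1

theorem AssumptionA1.exists_hasSum_self {K : ℝ → ℝ} (h : AssumptionA1 K) {T : ℝ} (hT : 0 < T) :
    ∃ c : ℕ → ℝ, (∀ k, 0 ≤ c k) ∧ ∀ y ∈ Ico (0 : ℝ) 1, HasSum (fun k => c k * y ^ k)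
      (K (T * √(1 - y)) - K T) := by
  simpa using h.exists_hasSum (a := 0) hT (by linarith [h.deriv_nonpos hT])

/-- A zero of `K'` at `t` makes `K` constant on `[t, ∞)`. The nonnegative power series based at `T >
t` then vanishes at a positive point, so all its coefficients are zero and `K` is constant on `(0,
T]`. Taking `T = t + s` puts the point `s` with `K'(s) ≠ 0` inside. -/
theorem AssumptionA1.deriv_neg {K : ℝ → ℝ} (h : AssumptionA1 K) {t : ℝ} (ht : 0 < t) :
    deriv K t < 0 := by
  refine lt_of_le_of_ne (h.deriv_nonpos ht) fun h0 => ?_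
  obtain ⟨s, hs, hs0⟩ := h.2.2
  have hs' : 0 < s := hs
  set T : ℝ := t + s with hTdef
  have hT : 0 < T := by positivity
  have hconst : ∀ u, t ≤ u → K u = K t := by
    intro u hu
    refine constant_of_derivWithin_zero (a := t) (b := u) (fun x hx => ?_) (fun x hx => ?_) u
      ⟨hu, le_rfl⟩
    · exact (h.hasDerivAt (ht.trans_le hx.1)).differentiableAt.differentiableWithinAt
    · have hx0 : 0 < x := ht.trans_le hx.1
      rw [(h.hasDerivAt hx0).hasDerivWithinAt.derivWithin
        ((uniqueDiffOn_Icc (hx.1.trans_lt hx.2)) x ⟨hx.1, hx.2.le⟩)]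
      have h1 := h.monotoneOn_deriv ht hx0 hx.1
      have h2 := h.deriv_nonpos hx0
      linarith
  obtain ⟨c, hc, hsum⟩ := h.exists_hasSum_self hT
  set r : ℝ := t / T with hr
  have hr0 : 0 < r := by positivity
  have hr1 : r < 1 := (div_lt_one hT).2 (by rw [hTdef]; linarith)
  have hrr : r ^ 2 < 1 := by nlinarith
  have hk0 : ∀ k, c k = 0 := by
    have h1 := hsum (1 - r ^ 2) ⟨by linarith, by nlinarith⟩
    rw [sub_sub_cancel, Real.sqrt_sq hr0.le, hr, mul_div_cancel₀ _ hT.ne',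
      hconst T (by rw [hTdef]; linarith), sub_self] at h1
    rw [hasSum_zero_iff_of_nonneg fun k => mul_nonneg (hc k) (pow_nonneg (by linarith) k)] at h1
    intro k
    exact (mul_eq_zero.1 (congrFun h1 k)).resolve_right (pow_ne_zero k (by linarith))
  have hK : ∀ u ∈ Ioc 0 T, K u = K T := by
    intro u hu
    have hu0 : 0 < u / T := div_pos hu.1 hT
    have hu1 : u / T ≤ 1 := (div_le_one hT).2 hu.2
    have h1 := hsum (1 - (u / T) ^ 2) ⟨by nlinarith, by nlinarith⟩
    simp only [hk0, zero_mul, sub_sub_cancel, Real.sqrt_sq hu0.le, mul_div_cancel₀ _ hT.ne'] at h1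
    linarith [h1.unique hasSum_zero]
  refine hs0 ?_
  have : K =ᶠ[nhds s] fun _ => K T := by
    filter_upwards [Ioo_mem_nhds hs' (show s < T by rw [hTdef]; linarith)] with u hu
    exact hK u ⟨hu.1, hu.2.le⟩
  rw [this.deriv_eq]
  simp

/-! ### Integrability of the profiles. -/

theorem div_pi_le_sin_half_or {η : ℝ} (hη : η ∈ Ioo 0 (2 * Real.pi)) :
    η / Real.pi ≤ Real.sin (η / 2) ∨ (2 * Real.pi - η) / Real.pi ≤ Real.sin (η / 2) := by
  have hpi := Real.pi_pos
  rcases le_total η Real.pi with h | h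
  · left
    have := Real.mul_le_sin (x := η / 2) (by linarith [hη.1]) (by linarith)
    calc η / Real.pi = 2 / Real.pi * (η / 2) := by field_simp
      _ ≤ _ := this
  · right
    have := Real.mul_le_sin (x := Real.pi - η / 2) (by linarith [hη.2]) (by linarith)
    rw [Real.sin_pi_sub] at this
    calc (2 * Real.pi - η) / Real.pi = 2 / Real.pi * (Real.pi - η / 2) := by field_simp
      _ ≤ _ := this

theorem AssumptionA1.intervalIntegrable_mul_rpow {K : ℝ → ℝ} (h : AssumptionA1 K) {β : ℝ}
    (hint : IntegrableOn (fun t : ℝ => |K t| * t ^ (-β)) (Ioo 0 1)) {M : ℝ} (hM : 0 ≤ M) :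
    IntervalIntegrable (fun t : ℝ => |K t| * t ^ (-β)) volume 0 M := by
  have h1 : IntervalIntegrable (fun t : ℝ => |K t| * t ^ (-β)) volume 0 1 :=
    (intervalIntegrable_iff_integrableOn_Ioo_of_le zero_le_one).2 hint
  have h2 : IntervalIntegrable (fun t : ℝ => |K t| * t ^ (-β)) volume 1 (max 1 M) := by
    refine ContinuousOn.intervalIntegrable ?_
    rw [uIcc_of_le (le_max_left _ _)]
    have hsub : Icc 1 (max 1 M) ⊆ Ioi (0 : ℝ) := fun x hx => zero_lt_one.trans_le hx.1
    exact (h.continuousOn.mono hsub).abs.mul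
      (ContinuousOn.rpow_const continuousOn_id fun x hx => Or.inl (hsub hx).ne')
  refine (h1.trans h2).mono_set ?_
  rw [uIcc_of_le hM, uIcc_of_le (by positivity)]
  exact Icc_subset_Icc_right (le_max_right _ _)

theorem sqrt_one_sub_cos_sq {η : ℝ} (hη : η ∈ Ioo 0 (2 * Real.pi)) :
    √(1 - 1 * Real.cos (η / 2) ^ 2) = Real.sin (η / 2) := by
  have hs : 0 < Real.sin (η / 2) := Real.sin_pos_of_pos_of_lt_pi (by linarith [hη.1])
    (by linarith [hη.2])
  rw [one_mul, ← Real.sin_sq, Real.sqrt_sq hs.le]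

theorem AssumptionA1.continuousOn_profile {K : ℝ → ℝ} (h : AssumptionA1 K) {T q : ℝ} (hT : 0 < T)
    (hq : q ∈ Ioc (0 : ℝ) 1) : ContinuousOn (profile K T q) (Ioo 0 (2 * Real.pi)) := by
  refine h.continuousOn.comp (Continuous.continuousOn (by fun_prop)) fun η hη => ?_
  have : 0 < √(1 - q * Real.cos (η / 2) ^ 2) :=
    Real.sqrt_pos.2 (by linarith [(mul_cos_sq_mem_Ico hq hη).2])
  exact mul_pos hT this

theorem AssumptionA1.intervalIntegrable_profile_mul_rpow {K : ℝ → ℝ} (h : AssumptionA1 K) {β : ℝ}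
    (hβ0 : 0 ≤ β) (hβ1 : β < 1)
    (hint : IntegrableOn (fun t : ℝ => |K t| * t ^ (-β)) (Ioo 0 1)) {T : ℝ} (hT : 0 < T) :
    IntervalIntegrable (fun η => |profile K T 1 η| * |Real.sin (η / 2)| ^ (-β)) volume 0
      (2 * Real.pi) := by
  have hpi := Real.pi_pos
  -- `K (T sin (η / 2))` lies between `K T` and `K (T x / π)`, with `x` the distance from `η` to an
  -- endpoint. The second summand of `E` accounts for `K T`, and `T ^ β` for rescaling the power.
  let E : ℝ → ℝ := fun t => T ^ β * (|K t| * t ^ (-β)) + T ^ β * |K T| * t ^ (-β)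
  have hE : IntervalIntegrable E volume 0 (2 * T) :=
    ((h.intervalIntegrable_mul_rpow hint (by positivity)).const_mul _).add
      ((intervalIntegral.intervalIntegrable_rpow' (by linarith)).const_mul _)
  have hE1 : IntervalIntegrable (fun η => E (T / Real.pi * η)) volume 0 (2 * Real.pi) := by
    have h1 := hE.comp_mul_left (c := T / Real.pi)
    rw [zero_div, show 2 * T / (T / Real.pi) = 2 * Real.pi by field_simp] at h1
    exact h1
  have hE2 : IntervalIntegrable (fun η => E (T / Real.pi * (2 * Real.pi - η))) volume 0
      (2 * Real.pi) := by
    have h1 := (hE1.comp_sub_left (2 * Real.pi)).symm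
    rwa [sub_zero, sub_self] at h1
  have hEnn : ∀ t, 0 < t → 0 ≤ E t := fun t ht => by positivity
  have hb : ∀ η ∈ Ioo 0 (2 * Real.pi), ∀ x, 0 < x → x / Real.pi ≤ Real.sin (η / 2) →
      |profile K T 1 η| * |Real.sin (η / 2)| ^ (-β) ≤ E (T / Real.pi * x) := by
    intro η hη x hx hxs
    have hxpi : 0 < x / Real.pi := by positivity
    have hs : 0 < Real.sin (η / 2) := hxpi.trans_le hxs
    have htx : T / Real.pi * x = T * (x / Real.pi) := by ring
    have hK1 : K T ≤ K (T * Real.sin (η / 2)) :=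
      h.antitoneOn (mul_pos hT hs) hT (mul_le_of_le_one_right hT.le (Real.sin_le_one _))
    have hK2 : K (T * Real.sin (η / 2)) ≤ K (T * (x / Real.pi)) :=
      h.antitoneOn (mul_pos hT hxpi) (mul_pos hT hs) (by gcongr)
    have hK3 : |K (T * Real.sin (η / 2))| ≤ |K (T * (x / Real.pi))| + |K T| :=
      (abs_le_max_abs_abs hK1 hK2).trans (max_le (by linarith [abs_nonneg (K (T * (x / Real.pi)))])
        (by linarith [abs_nonneg (K T)]))
    have hr : |Real.sin (η / 2)| ^ (-β) ≤ (x / Real.pi) ^ (-β) := by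
      rw [abs_of_pos hs]
      exact Real.rpow_le_rpow_of_nonpos hxpi hxs (by linarith)
    have hTβ : (x / Real.pi) ^ (-β) = T ^ β * (T * (x / Real.pi)) ^ (-β) := by
      rw [Real.mul_rpow hT.le hxpi.le, ← mul_assoc, ← Real.rpow_add hT]
      simp
    rw [profile, sqrt_one_sub_cos_sq hη]
    calc _ ≤ (|K (T * (x / Real.pi))| + |K T|) * (x / Real.pi) ^ (-β) := by gcongr
      _ = E (T / Real.pi * x) := by rw [hTβ]; simp only [E, htx]; ring
  rw [intervalIntegrable_iff_integrableOn_Ioo_of_le Real.two_pi_pos.le]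
  have hEE := (intervalIntegrable_iff_integrableOn_Ioo_of_le Real.two_pi_pos.le).1 (hE1.add hE2)
  refine Integrable.mono' hEE ?_ ?_
  · refine ContinuousOn.aestronglyMeasurable ?_ measurableSet_Ioo
    refine (h.continuousOn_profile hT ⟨one_pos, le_rfl⟩).abs.mul
      (ContinuousOn.rpow_const (Continuous.continuousOn (by fun_prop)) fun η hη => Or.inl ?_)
    exact abs_ne_zero.2 (Real.sin_pos_of_pos_of_lt_pi (by linarith [hη.1])
      (by linarith [hη.2])).ne'
  · refine (ae_restrict_iff' measurableSet_Ioo).2 (Filter.Eventually.of_forall fun η hη => ?_)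
    have h1 := hEnn (T / Real.pi * η) (mul_pos (by positivity) hη.1)
    have h2 := hEnn (T / Real.pi * (2 * Real.pi - η)) (mul_pos (by positivity) (by linarith [hη.2]))
    rw [Real.norm_of_nonneg (by positivity)]
    rcases div_pi_le_sin_half_or hη with h3 | h3
    · linarith [hb η hη η hη.1 h3]
    · linarith [hb η hη _ (by linarith [hη.2]) h3]

/-- As `K` decreases, the profile for `q` lies between `K T` and the profile for `q = 1`. -/
theorem AssumptionA1.intervalIntegrable_profile {K : ℝ → ℝ} (h : AssumptionA1 K) {β : ℝ}
    (hβ0 : 0 ≤ β) (hβ1 : β < 1)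
    (hint : IntegrableOn (fun t : ℝ => |K t| * t ^ (-β)) (Ioo 0 1)) {T q : ℝ} (hT : 0 < T)
    (hq : q ∈ Ioc (0 : ℝ) 1) :
    IntervalIntegrable (profile K T q) volume 0 (2 * Real.pi) := by
  have h1 := (h.intervalIntegrable_profile_mul_rpow hβ0 hβ1 hint hT).add
    (intervalIntegrable_const (c := |K T|))
  rw [intervalIntegrable_iff_integrableOn_Ioo_of_le Real.two_pi_pos.le] at h1 ⊢
  refine Integrable.mono' h1
    ((h.continuousOn_profile hT hq).aestronglyMeasurable measurableSet_Ioo)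
    ((ae_restrict_iff' measurableSet_Ioo).2 (Filter.Eventually.of_forall fun η hη => ?_))
  have hs : 0 < Real.sin (η / 2) := Real.sin_pos_of_pos_of_lt_pi (by linarith [hη.1])
    (by linarith [hη.2])
  have hsq := sqrt_one_sub_cos_sq hη
  have h2 : Real.sin (η / 2) ≤ √(1 - q * Real.cos (η / 2) ^ 2) := by
    rw [← hsq]
    gcongr
    exact hq.2
  have h3 : √(1 - q * Real.cos (η / 2) ^ 2) ≤ 1 :=
    Real.sqrt_le_one.2 (by linarith [(mul_cos_sq_mem_Ico hq hη).1])
  have hK1 : K T ≤ profile K T q η :=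
    h.antitoneOn (mul_pos hT (hs.trans_le h2)) hT (mul_le_of_le_one_right hT.le h3)
  have hK2 : profile K T q η ≤ profile K T 1 η := by
    unfold profile
    rw [hsq]
    exact h.antitoneOn (mul_pos hT hs) (mul_pos hT (hs.trans_le h2)) (by gcongr)
  have h4 : 1 ≤ |Real.sin (η / 2)| ^ (-β) :=
    Real.one_le_rpow_of_pos_of_le_one_of_nonpos (abs_pos.2 hs.ne') (Real.abs_sin_le_one _)
      (by linarith)
  have h5 := le_mul_of_one_le_right (abs_nonneg (profile K T 1 η)) h4
  rw [Real.norm_eq_abs]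
  refine (abs_le_max_abs_abs hK1 hK2).trans (max_le ?_ ?_)
  · linarith [abs_nonneg (profile K T 1 η)]
  · linarith [abs_nonneg (K T)]

/-! ### Decay of decreasing cosine coefficients. -/

theorem two_mul_sin_mul_sum_cos (n : ℕ) (η : ℝ) :
    2 * Real.sin (η / 2) * ∑ m ∈ Finset.range n, Real.cos ((m + 1 : ℕ) * η)
      = Real.sin (n * η + η / 2) - Real.sin (η / 2) := by
  induction n with
  | zero => simp
  | succ n ih =>
    rw [Finset.sum_range_succ, mul_add, ih]
    have h1 : (n : ℝ) * η + η / 2 = (n + 1 : ℕ) * η - η / 2 := by push_cast; ring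
    rw [h1, Real.sin_sub, Real.sin_add]
    ring

/-- Geometric interpolation between the bounds `n` and `1 / |sin (η / 2)|`. -/
theorem abs_sum_cos_le (n : ℕ) {β : ℝ} (hβ0 : 0 ≤ β) (hβ1 : β ≤ 1) {η : ℝ}
    (hη : Real.sin (η / 2) ≠ 0) :
    |∑ m ∈ Finset.range n, Real.cos ((m + 1 : ℕ) * η)|
      ≤ (n : ℝ) ^ (1 - β) * |Real.sin (η / 2)| ^ (-β) := by
  set x := |∑ m ∈ Finset.range n, Real.cos ((m + 1 : ℕ) * η)| with hx
  have hs : 0 < |Real.sin (η / 2)| := abs_pos.2 hη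
  have h1 : x ≤ n := by
    refine (Finset.abs_sum_le_sum_abs _ _).trans ?_
    refine (Finset.sum_le_sum fun m _ => Real.abs_cos_le_one _).trans ?_
    simp
  have h2 : x ≤ |Real.sin (η / 2)|⁻¹ := by
    have h3 := congrArg abs (two_mul_sin_mul_sum_cos n η)
    rw [abs_mul, abs_mul, abs_two, ← hx] at h3
    have h4 : |Real.sin (n * η + η / 2) - Real.sin (η / 2)| ≤ 1 + 1 :=
      (abs_sub _ _).trans (add_le_add (Real.abs_sin_le_one _) (Real.abs_sin_le_one _))
    rw [← one_div, le_div_iff₀ hs]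
    linarith
  have hx0 : 0 ≤ x := abs_nonneg _
  rcases hx0.eq_or_lt with h0 | h0
  · rw [← h0]; positivity
  · calc x = x ^ (1 - β) * x ^ β := by rw [← Real.rpow_add h0]; simp
      _ ≤ (n : ℝ) ^ (1 - β) * (|Real.sin (η / 2)|⁻¹) ^ β := by
        gcongr
      _ = _ := by rw [Real.inv_rpow hs.le, Real.rpow_neg hs.le]

theorem nat_mul_le_sum_of_anti {L : ℕ → ℝ} (hL : ∀ m n, 1 ≤ m → m ≤ n → L n ≤ L m) (n : ℕ) :
    n * L n ≤ ∑ m ∈ Finset.range n, L (m + 1) := by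
  calc (n : ℝ) * L n = ∑ m ∈ Finset.range n, L n := by simp
    _ ≤ _ := Finset.sum_le_sum fun m hm =>
      hL _ _ (by omega) (by have := Finset.mem_range.1 hm; omega)

theorem nat_mul_cosCoeff_le {Φ : ℝ → ℝ} {β : ℝ} (hβ0 : 0 ≤ β) (hβ1 : β ≤ 1)
    (hΦ : IntervalIntegrable Φ volume 0 (2 * Real.pi))
    (hint : IntervalIntegrable (fun η => |Φ η| * |Real.sin (η / 2)| ^ (-β)) volume 0
      (2 * Real.pi))
    (hL : ∀ m n, 1 ≤ m → m ≤ n → cosCoeff Φ n ≤ cosCoeff Φ m) (n : ℕ) :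
    n * cosCoeff Φ n ≤ (n : ℝ) ^ (1 - β)
      * ∫ η in (0 : ℝ)..(2 * Real.pi), |Φ η| * |Real.sin (η / 2)| ^ (-β) := by
  refine (nat_mul_le_sum_of_anti hL n).trans ?_
  have hi : ∀ m ∈ Finset.range n,
      IntervalIntegrable (fun η => Φ η * Real.cos ((m + 1 : ℕ) * η)) volume 0 (2 * Real.pi) :=
    fun m _ => hΦ.mul_continuousOn (by fun_prop)
  unfold cosCoeff
  rw [← intervalIntegral.integral_finsetSum hi, ← intervalIntegral.integral_const_mul]
  refine intervalIntegral.integral_mono_on_of_le_Ioo Real.two_pi_pos.le ?_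
    (hint.const_mul _) fun η hη => ?_
  · have := IntervalIntegrable.sum (Finset.range n) hi
    exact this.congr (fun η _ => by simp)
  · have hs : 0 < Real.sin (η / 2) := Real.sin_pos_of_pos_of_lt_pi (by linarith [hη.1])
      (by linarith [hη.2])
    rw [← Finset.mul_sum]
    refine (le_abs_self _).trans ?_
    rw [abs_mul]
    have := mul_le_mul_of_nonneg_left (abs_sum_cos_le n hβ0 hβ1 hs.ne') (abs_nonneg (Φ η))
    linarith

/-- For `q = 1` the profile is `T sin (η / 2)` on `[0, 2π]`; product-to-sum formulas give a
primitive. -/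
theorem cosCoeff_profile_id (T : ℝ) {n : ℕ} (hn : 1 ≤ n) :
    cosCoeff (profile (fun t => t) T 1) n = -(4 * T / (4 * n ^ 2 - 1)) := by
  have hn1 : (1 : ℝ) ≤ n := by exact_mod_cast hn
  have h1 : (2 * n - 1 : ℝ) ≠ 0 := by linarith
  have h2 : (2 * n + 1 : ℝ) ≠ 0 := by linarith
  have hcongr : ∀ η ∈ uIcc 0 (2 * Real.pi), profile (fun t => t) T 1 η * Real.cos (n * η)
      = T * Real.sin (η / 2) * Real.cos (n * η) := by
    intro η hη
    rw [uIcc_of_le Real.two_pi_pos.le] at hη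
    have hs : 0 ≤ Real.sin (η / 2) :=
      Real.sin_nonneg_of_nonneg_of_le_pi (by linarith [hη.1]) (by linarith [hη.2])
    simp only [profile, one_mul]
    rw [← Real.sin_sq, Real.sqrt_sq hs]
  have hderiv : ∀ η ∈ uIcc 0 (2 * Real.pi), HasDerivAt
      (fun η : ℝ => T * (Real.cos ((n - 1 / 2) * η) / (2 * n - 1)
        - Real.cos ((n + 1 / 2) * η) / (2 * n + 1)))
      (T * Real.sin (η / 2) * Real.cos (n * η)) η := by
    intro η _
    have hlin : ∀ a : ℝ, HasDerivAt (fun η : ℝ => Real.cos (a * η)) (-Real.sin (a * η) * a) η :=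
      fun a => by simpa using ((hasDerivAt_id η).const_mul a).cos
    refine ((((hlin _).div_const _).sub ((hlin _).div_const _)).const_mul T).congr_deriv ?_
    have e1 : (n - 1 / 2 : ℝ) * η = n * η - η / 2 := by ring
    have e2 : (n + 1 / 2 : ℝ) * η = n * η + η / 2 := by ring
    have e3 : ∀ x : ℝ, x * (n - 1 / 2) / (2 * n - 1) = x / 2 := fun x => by
      rw [div_eq_div_iff h1 two_ne_zero]
      ring
    have e4 : ∀ x : ℝ, x * (n + 1 / 2) / (2 * n + 1) = x / 2 := fun x => by
      rw [div_eq_div_iff h2 two_ne_zero]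
      ring
    rw [e3, e4, e1, e2, Real.sin_sub, Real.sin_add]
    ring
  rw [cosCoeff, intervalIntegral.integral_congr hcongr,
    intervalIntegral.integral_eq_sub_of_hasDerivAt hderiv
      (Continuous.intervalIntegrable (by fun_prop) _ _)]
  have e1 : (n - 1 / 2 : ℝ) * (2 * Real.pi) = n * (2 * Real.pi) - Real.pi := by ring
  have e2 : (n + 1 / 2 : ℝ) * (2 * Real.pi) = n * (2 * Real.pi) + Real.pi := by ring
  have h3 : (4 * n ^ 2 - 1 : ℝ) = (2 * n - 1) * (2 * n + 1) := by ring
  rw [e1, e2, Real.cos_nat_mul_two_pi_sub_pi, Real.cos_nat_mul_two_pi_add_pi, h3]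
  simp only [mul_zero, Real.cos_zero]
  field_simp
  ring

/-! ### Two-sided bounds for the coefficients of the kernel. -/

section Bounds

variable {K : ℝ → ℝ} {β T : ℝ}

/-- The same `c` serves every `q`, which allows comparison between different values of `q`. -/
theorem AssumptionA1.isCosWeightSum (h : AssumptionA1 K) (hβ0 : 0 ≤ β) (hβ1 : β < 1)
    (hint : IntegrableOn (fun t : ℝ => |K t| * t ^ (-β)) (Ioo 0 1)) (hT : 0 < T) :
    ∃ c : ℕ → ℝ, (∀ k, 0 ≤ c k) ∧
      (∀ y ∈ Ico (0 : ℝ) 1, HasSum (fun k => c k * y ^ k) (K (T * √(1 - y)) - K T)) ∧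
      ∀ q ∈ Ioc (0 : ℝ) 1, IsCosWeightSum (fun k => c k * q ^ k) (cosCoeff (profile K T q)) := by
  obtain ⟨c, hc, hsum⟩ := h.exists_hasSum_self hT
  exact ⟨c, hc, hsum, fun q hq => isCosWeightSum_cosCoeff_profile hc hsum hq
    (h.intervalIntegrable_profile hβ0 hβ1 hint hT hq)⟩

theorem AssumptionA1.isCosWeightSum_sub (h : AssumptionA1 K) (hβ0 : 0 ≤ β) (hβ1 : β < 1)
    (hint : IntegrableOn (fun t : ℝ => |K t| * t ^ (-β)) (Ioo 0 1)) (hT : 0 < T) :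
    ∃ c L : ℕ → ℝ, IsCosWeightSum c L ∧ ∀ n, 1 ≤ n →
      L n = cosCoeff (profile K T 1) n - -deriv K T * (4 * T / (4 * n ^ 2 - 1)) := by
  obtain ⟨c, hc, hsum⟩ := h.exists_hasSum hT le_rfl
  have hq : (1 : ℝ) ∈ Ioc (0 : ℝ) 1 := ⟨one_pos, le_rfl⟩
  have hi := h.intervalIntegrable_profile hβ0 hβ1 hint hT hq
  have hid : IntervalIntegrable (profile (fun t => t) T 1) volume 0 (2 * Real.pi) :=
    Continuous.intervalIntegrable (by unfold profile; fun_prop) _ _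
  have hprof : profile (fun t => K t + -deriv K T * t) T 1
      = fun η => profile K T 1 η + -deriv K T * profile (fun t => t) T 1 η := rfl
  have hsum' := isCosWeightSum_cosCoeff_profile (K := fun t => K t + -deriv K T * t) hc hsum hq
    (by rw [hprof]; exact hi.add (hid.const_mul _))
  refine ⟨_, _, hsum', fun n hn => ?_⟩
  have h1 : IntervalIntegrable (fun η => profile K T 1 η * Real.cos (n * η)) volume 0
      (2 * Real.pi) := hi.mul_continuousOn (by fun_prop)
  have h2 : IntervalIntegrable (fun η => profile (fun t => t) T 1 η * Real.cos (n * η)) volume 0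
      (2 * Real.pi) := hid.mul_continuousOn (by fun_prop)
  have h3 := cosCoeff_profile_id T hn
  rw [hprof]
  unfold cosCoeff at h3 ⊢
  simp_rw [add_mul, mul_assoc]
  rw [intervalIntegral.integral_add h1 (h2.const_mul _), intervalIntegral.integral_const_mul, h3]
  ring

/-- After removal of the linear part the coefficients are still nonnegative and decreasing, so the
coefficients of `K` and their differences dominate those of the linear part. -/
theorem AssumptionA1.le_cosCoeff (h : AssumptionA1 K) (hβ0 : 0 ≤ β) (hβ1 : β < 1)
    (hint : IntegrableOn (fun t : ℝ => |K t| * t ^ (-β)) (Ioo 0 1)) (hT : 0 < T) {n : ℕ}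
    (hn : 1 ≤ n) :
    -deriv K T * T / n ^ 2 ≤ cosCoeff (profile K T 1) n ∧
      -deriv K T * T / (2 * n ^ 3)
        ≤ cosCoeff (profile K T 1) n - cosCoeff (profile K T 1) (n + 1) := by
  obtain ⟨c, L, hL, hLn⟩ := h.isCosWeightSum_sub hβ0 hβ1 hint hT
  have ha : 0 < -deriv K T * T := mul_pos (neg_pos.2 (h.deriv_neg hT)) hT
  have h1 := hL.nonneg hn
  have h2 := hL.succ_le hn
  rw [hLn n hn] at h1 h2
  rw [hLn (n + 1) (by omega)] at h2
  have hn1 : (1 : ℝ) ≤ n := by exact_mod_cast hn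
  have hp1 : (0 : ℝ) < 4 * n ^ 2 - 1 := by nlinarith
  have hp2 : (0 : ℝ) < 4 * (n + 1 : ℝ) ^ 2 - 1 := by nlinarith
  push_cast at h2
  constructor
  · have h3 : (1 : ℝ) / n ^ 2 ≤ 4 / (4 * n ^ 2 - 1) := by
      rw [div_le_div_iff₀ (by positivity) hp1]
      linarith
    have h4 := mul_le_mul_of_nonneg_left h3 ha.le
    have e1 : -deriv K T * T / n ^ 2 = -deriv K T * T * (1 / n ^ 2) := by ring
    have e2 : -deriv K T * (4 * T / (4 * n ^ 2 - 1)) = -deriv K T * T * (4 / (4 * n ^ 2 - 1)) := by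
      ring
    linarith
  · have h3 : (1 : ℝ) / (2 * n ^ 3) ≤ 4 / (4 * n ^ 2 - 1) - 4 / (4 * (n + 1 : ℝ) ^ 2 - 1) := by
      have e : (4 : ℝ) / (4 * n ^ 2 - 1) - 4 / (4 * (n + 1 : ℝ) ^ 2 - 1)
          = 16 / ((2 * n - 1) * (2 * n + 1) * (2 * n + 3)) := by
        have q1 : (2 * n - 1 : ℝ) ≠ 0 := by linarith
        have q2 : (2 * n + 1 : ℝ) ≠ 0 := by linarith
        have q3 : (2 * n + 3 : ℝ) ≠ 0 := by linarith
        rw [show (4 * n ^ 2 - 1 : ℝ) = (2 * n - 1) * (2 * n + 1) by ring,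
          show (4 * (n + 1) ^ 2 - 1 : ℝ) = (2 * n + 1) * (2 * n + 3) by ring]
        field_simp
        ring
      have hden : (0 : ℝ) < (2 * n - 1) * (2 * n + 1) * (2 * n + 3) :=
        mul_pos (mul_pos (by linarith) (by linarith)) (by linarith)
      rw [e, div_le_div_iff₀ (by positivity) hden]
      have h5 : (2 * n - 1 : ℝ) * (2 * n + 1) ≤ 4 * n ^ 2 := by nlinarith
      have h6 : (2 * n + 3 : ℝ) ≤ 5 * n := by linarith
      have h7 := mul_le_mul h5 h6 (by linarith) (by positivity)
      have h8 : (0 : ℝ) ≤ n ^ 3 := by positivity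
      calc _ = (2 * n - 1 : ℝ) * (2 * n + 1) * (2 * n + 3) := one_mul _
        _ ≤ _ := h7
        _ = 20 * n ^ 3 := by ring
        _ ≤ _ := by linarith
    have h4 := mul_le_mul_of_nonneg_left h3 ha.le
    have e1 : -deriv K T * T / (2 * n ^ 3) = -deriv K T * T * (1 / (2 * n ^ 3)) := by ring
    have e2 : -deriv K T * T * (4 / (4 * n ^ 2 - 1) - 4 / (4 * (n + 1 : ℝ) ^ 2 - 1))
        = -deriv K T * (4 * T / (4 * n ^ 2 - 1))
          - -deriv K T * (4 * T / (4 * (n + 1 : ℝ) ^ 2 - 1)) := by ring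
    linarith

theorem AssumptionA1.exists_cosCoeff_le (h : AssumptionA1 K) (hβ0 : 0 ≤ β) (hβ1 : β < 1)
    (hint : IntegrableOn (fun t : ℝ => |K t| * t ^ (-β)) (Ioo 0 1)) (hT : 0 < T) :
    ∃ C : ℝ, 0 ≤ C ∧ ∀ n : ℕ, 1 ≤ n → cosCoeff (profile K T 1) n ≤ C / (n : ℝ) ^ β := by
  have hq : (1 : ℝ) ∈ Ioc (0 : ℝ) 1 := ⟨one_pos, le_rfl⟩
  obtain ⟨c, -, -, hc⟩ := h.isCosWeightSum hβ0 hβ1 hint hT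
  refine ⟨∫ η in (0 : ℝ)..(2 * Real.pi), |profile K T 1 η| * |Real.sin (η / 2)| ^ (-β),
    intervalIntegral.integral_nonneg Real.two_pi_pos.le fun η _ => by positivity, fun n hn => ?_⟩
  have hn0 : (0 : ℝ) < n := by exact_mod_cast hn
  have h1 := nat_mul_cosCoeff_le hβ0 hβ1.le (h.intervalIntegrable_profile hβ0 hβ1 hint hT hq)
    (h.intervalIntegrable_profile_mul_rpow hβ0 hβ1 hint hT) (fun _ _ => (hc 1 hq).anti) n
  rw [Real.rpow_sub hn0, Real.rpow_one, div_mul_eq_mul_div, mul_div_assoc] at h1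
  exact le_of_mul_le_mul_left h1 hn0

theorem IsCosWeightSum.sub_succ_le {a L : ℕ → ℝ} (h : IsCosWeightSum a L) {C : ℝ} (hβ0 : 0 ≤ β)
    (hβ1 : β ≤ 1) (hC : ∀ n : ℕ, 1 ≤ n → L n ≤ C / (n : ℝ) ^ β) {n : ℕ} (hn : 1 ≤ n) :
    L n - L (n + 1) ≤ 8 * C / (n : ℝ) ^ (1 + β) := by
  have hC0 : 0 ≤ C := by simpa using (h.nonneg le_rfl).trans (hC 1 le_rfl)
  -- `m = ⌈n / 2⌉`: each difference between `m` and `n` is at least `(2m + 1) * e`, so their sum, at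
  -- most `L m`, is at least `(n / 2) * (n + 1) * e`.
  obtain ⟨m, hm1, hmn, hm2⟩ : ∃ m : ℕ, 1 ≤ m ∧ n ≤ 2 * m ∧ 2 * m ≤ n + 1 :=
    ⟨(n + 1) / 2, by omega, by omega, by omega⟩
  set e := (L n - L (n + 1)) / (2 * n + 1) with he
  have he0 : 0 ≤ e := div_nonneg (sub_nonneg.2 (h.succ_le hn)) (by positivity)
  have key : ∀ N, m ≤ N → N ≤ n + 1 → (N - m : ℝ) * ((2 * m + 1) * e) ≤ L m - L N := by
    intro N hN
    induction N, hN using Nat.le_induction with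
    | base => simp
    | succ N hN ih =>
      intro hNn
      have h1 := ih (by omega)
      have h2 := h.sub_div_anti (hm1.trans hN) (show N ≤ n by omega)
      rw [← he, le_div_iff₀ (by positivity)] at h2
      have h3 : (m : ℝ) ≤ N := by exact_mod_cast hN
      push_cast
      nlinarith
  have h1 := key (n + 1) (by omega) le_rfl
  have hLn := h.nonneg (show 1 ≤ n + 1 by omega)
  have hn0 : (1 : ℝ) ≤ n := by exact_mod_cast hn
  have hmn' : (n : ℝ) ≤ 2 * m := by exact_mod_cast hmn
  have hm2' : (2 * m : ℝ) ≤ n + 1 := by exact_mod_cast hm2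
  have h2 : (n / 2 : ℝ) * ((n + 1) * e) ≤ L m := by
    refine le_trans ?_ (h1.trans (by linarith))
    push_cast
    gcongr <;> linarith
  have h3 : L m ≤ 2 * C / (n : ℝ) ^ β := by
    refine (hC m hm1).trans ?_
    have hm0 : (0 : ℝ) < m := by linarith
    rw [div_le_div_iff₀ (by positivity) (by positivity)]
    have h4 : (n : ℝ) ^ β ≤ 2 * (m : ℝ) ^ β := by
      calc (n : ℝ) ^ β ≤ (2 * m : ℝ) ^ β := by gcongr
        _ = 2 ^ β * (m : ℝ) ^ β := Real.mul_rpow zero_le_two hm0.le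
        _ ≤ 2 ^ (1 : ℝ) * (m : ℝ) ^ β := by gcongr; norm_num
        _ = _ := by rw [Real.rpow_one]
    nlinarith
  have h5 : L n - L (n + 1) = (2 * n + 1) * e := by
    rw [he]
    field_simp
  rw [h5, Real.rpow_add (by linarith), Real.rpow_one]
  have h6 : (n : ℝ) * ((2 * n + 1) * e) ≤ 8 * C / (n : ℝ) ^ β := by
    have h7 : 8 * C / (n : ℝ) ^ β = 4 * (2 * C / (n : ℝ) ^ β) := by ring
    rw [h7]
    nlinarith [mul_nonneg (by linarith : (0 : ℝ) ≤ n) he0]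
  rw [mul_comm (n : ℝ), ← div_div, le_div_iff₀ (by linarith)]
  linarith

/-- Positivity at `q = 1` forces some term `c k * cosWeight k n` to be positive, and the factor `q ^
k` keeps it so. -/
theorem AssumptionA1.cosCoeff_profile_pos (h : AssumptionA1 K) (hβ0 : 0 ≤ β) (hβ1 : β < 1)
    (hint : IntegrableOn (fun t : ℝ => |K t| * t ^ (-β)) (Ioo 0 1)) (hT : 0 < T) {q : ℝ}
    (hq : q ∈ Ioc (0 : ℝ) 1) {n : ℕ} (hn : 1 ≤ n) : 0 < cosCoeff (profile K T q) n := by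
  obtain ⟨c, hc0, -, hc⟩ := h.isCosWeightSum hβ0 hβ1 hint hT
  have h1 : 0 < cosCoeff (profile K T 1) n := by
    refine lt_of_lt_of_le ?_ (h.le_cosCoeff hβ0 hβ1 hint hT hn).1
    have := mul_pos (neg_pos.2 (h.deriv_neg hT)) hT
    positivity
  have h2 := (hc 1 ⟨one_pos, le_rfl⟩).2 n hn
  obtain ⟨k, hk⟩ : ∃ k, c k * 1 ^ k * cosWeight k n ≠ 0 := by
    by_contra! hcon
    simp only [hcon] at h2
    exact h1.ne' (h2.unique hasSum_zero)
  have hck : 0 < c k := lt_of_le_of_ne (hc0 k) fun h0 => hk (by rw [← h0]; ring)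
  have hwk : 0 < cosWeight k n :=
    lt_of_le_of_ne (cosWeight_nonneg k n) fun h0 => hk (by rw [← h0]; ring)
  have h3 := (hc q hq).2 n hn
  have hqk := pow_pos hq.1 k
  exact lt_of_lt_of_le (by positivity) (le_hasSum h3 k fun j _ =>
    mul_nonneg (mul_nonneg (hc0 j) (pow_nonneg hq.1.le j)) (cosWeight_nonneg j n))

theorem AssumptionA1.exists_cosCoeff_profile_le_geometric (h : AssumptionA1 K) (hβ0 : 0 ≤ β)
    (hβ1 : β < 1) (hint : IntegrableOn (fun t : ℝ => |K t| * t ^ (-β)) (Ioo 0 1)) (hT : 0 < T)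
    {q : ℝ} (hq : q ∈ Ioo (0 : ℝ) 1) :
    ∃ s ∈ Ioo (0 : ℝ) 1, ∃ C : ℝ, ∀ n : ℕ, 1 ≤ n → cosCoeff (profile K T q) n ≤ C * s ^ n := by
  obtain ⟨c, hc0, hcK, hc⟩ := h.isCosWeightSum hβ0 hβ1 hint hT
  have hq0 := hq.1
  have hq1 := hq.2
  -- Chosen so that `q < s² < 1`. Convergence at `q / s²` bounds `c k * q ^ k` by `S * s ^ (2k)`;
  -- for `k ≥ n` one factor `s ^ k` gives `s ^ n` and the other is summed.
  set s : ℝ := √((1 + q) / 2) with hs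
  have hs2 : s ^ 2 = (1 + q) / 2 := Real.sq_sqrt (by linarith)
  have hs0 : 0 < s := Real.sqrt_pos.2 (by linarith)
  have hs1 : s < 1 := by nlinarith
  have hρ : q / s ^ 2 ∈ Ico (0 : ℝ) 1 := by
    refine ⟨by positivity, (div_lt_one (by positivity)).2 ?_⟩
    rw [hs2]
    linarith
  set S := K (T * √(1 - q / s ^ 2)) - K T with hS
  have hle : ∀ k, c k * (q / s ^ 2) ^ k ≤ S := fun k =>
    le_hasSum (hcK _ hρ) k fun j _ => mul_nonneg (hc0 j) (pow_nonneg hρ.1 j)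
  have hS0 : 0 ≤ S := (hcK _ hρ).nonneg fun j => mul_nonneg (hc0 j) (pow_nonneg hρ.1 j)
  refine ⟨s, ⟨hs0, hs1⟩, S * (2 * Real.pi) * (1 - s)⁻¹, fun n hn => ?_⟩
  have h1 := (hc q ⟨hq0, hq1.le⟩).2 n hn
  have h2 := (hasSum_geometric_of_lt_one hs0.le hs1).mul_left (S * (2 * Real.pi) * s ^ n)
  refine (hasSum_le (fun k => ?_) h1 h2).trans (le_of_eq (by ring))
  have hpi := Real.two_pi_pos
  by_cases hk : k < n
  · rw [cosWeight_eq_zero hk, mul_zero]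
    positivity
  · have h3 : c k * q ^ k = c k * (q / s ^ 2) ^ k * (s ^ k * s ^ k) := by
      rw [div_pow, ← pow_mul, mul_comm 2 k, pow_mul]
      field_simp
    have h4 : s ^ k ≤ s ^ n := pow_le_pow_of_le_one hs0.le hs1.le (not_lt.1 hk)
    beta_reduce
    rw [h3]
    calc _ ≤ S * (s ^ n * s ^ k) * (2 * Real.pi) :=
          mul_le_mul (mul_le_mul (hle k) (by gcongr) (by positivity) hS0) (cosWeight_le k n)
            (cosWeight_nonneg k n) (by positivity)
      _ = _ := by ring

end Bounds

/-! ### Decay for the smooth kernel. -/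

theorem exists_mul_pow_le_div_pow {s : ℝ} (hs : s ∈ Ioo (0 : ℝ) 1) (C : ℝ) (k : ℕ) :
    ∃ C' : ℝ, 0 < C' ∧ ∀ n : ℕ, 1 ≤ n → C * s ^ n ≤ C' / (n : ℝ) ^ k := by
  have h1 := (tendsto_pow_const_mul_const_pow_of_abs_lt_one k
    (show |s| < 1 by rw [abs_of_pos hs.1]; exact hs.2)).const_mul C
  obtain ⟨M, hM⟩ := h1.bddAbove_range
  refine ⟨max M 1, by positivity, fun n hn => ?_⟩
  have hn0 : (0 : ℝ) < n := by exact_mod_cast hn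
  rw [le_div_iff₀ (by positivity)]
  refine le_trans ?_ ((hM ⟨n, rfl⟩).trans (le_max_left _ _))
  exact le_of_eq (by ring)

/-- Each integration by parts gains a factor `1 / n`; periodicity cancels the boundary terms. -/
theorem exists_norm_integral_mul_exp_le (k : ℕ) : ∀ {f : ℝ → ℂ}, ContDiff ℝ k f →
    Function.Periodic f (2 * Real.pi) → ∃ C : ℝ, 0 ≤ C ∧ ∀ n : ℕ, 1 ≤ n →
      ‖∫ η in (0 : ℝ)..(2 * Real.pi), f η * Complex.exp (Complex.I * n * η)‖
        ≤ C / (n : ℝ) ^ k := by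
  have hexp : ∀ (n : ℕ) (η : ℝ), ‖Complex.exp (Complex.I * n * η)‖ = 1 := by
    intro n η
    rw [show Complex.I * n * η = ((n * η : ℝ) : ℂ) * Complex.I by push_cast; ring,
      Complex.norm_exp_ofReal_mul_I]
  induction k with
  | zero =>
    intro f _ _
    refine ⟨∫ η in (0 : ℝ)..(2 * Real.pi), ‖f η‖,
      intervalIntegral.integral_nonneg Real.two_pi_pos.le fun η _ => norm_nonneg _, fun n _ => ?_⟩
    refine (intervalIntegral.norm_integral_le_integral_norm Real.two_pi_pos.le).trans ?_
    simp [hexp]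
  | succ k ih =>
    intro f hf hper
    have hf' : ContDiff ℝ k (deriv f) :=
      ((contDiff_succ_iff_deriv (n := (k : WithTop ℕ∞))).1 (by exact_mod_cast hf)).2.2
    have hdiff : Differentiable ℝ f := hf.differentiable (by simp)
    have hper' : Function.Periodic (deriv f) (2 * Real.pi) := by
      intro η
      rw [← deriv_comp_add_const, hper.funext]
    obtain ⟨C, hC0, hC⟩ := ih hf' hper'
    refine ⟨C, hC0, fun n hn => ?_⟩
    have hn0 : (0 : ℝ) < n := by exact_mod_cast hn
    have hIn : Complex.I * n ≠ 0 :=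
      mul_ne_zero Complex.I_ne_zero (by exact_mod_cast hn0.ne')
    have hv : ∀ η ∈ uIcc 0 (2 * Real.pi), HasDerivAt
        (fun η : ℝ => Complex.exp (Complex.I * n * η) / (Complex.I * n))
        (Complex.exp (Complex.I * n * η)) η := by
      intro η _
      have h1 : HasDerivAt (fun η : ℝ => Complex.I * n * (η : ℂ)) (Complex.I * n) η := by
        simpa using (Complex.ofRealCLM.hasDerivAt (x := η)).const_mul (Complex.I * n)
      exact (h1.cexp.div_const _).congr_deriv (mul_div_cancel_right₀ _ hIn)
    have hparts := intervalIntegral.integral_mul_deriv_eq_deriv_mul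
      (fun η _ => (hdiff η).hasDerivAt) hv
      (hf'.continuous.intervalIntegrable _ _)
      (Continuous.intervalIntegrable (by fun_prop) _ _)
    have hend : Complex.exp (Complex.I * n * ((2 * Real.pi : ℝ) : ℂ)) = 1 := by
      rw [show Complex.I * n * ((2 * Real.pi : ℝ) : ℂ) = n * (2 * Real.pi * Complex.I) by
        push_cast; ring, Complex.exp_nat_mul_two_pi_mul_I]
    have hf0 : f (2 * Real.pi) = f 0 := by simpa using hper 0
    rw [hparts, hend, hf0]
    simp only [Complex.ofReal_zero, mul_zero, Complex.exp_zero, sub_self, zero_sub, norm_neg,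
      ← mul_div_assoc]
    rw [intervalIntegral.integral_div, norm_div]
    have h2 : ‖Complex.I * n‖ = n := by simp
    rw [h2, pow_succ, ← div_div]
    gcongr
    exact hC n hn

theorem exists_norm_integral_kernel_le {D : Set ℂ} {K₁ : ℂ → ℂ → ℝ}
    (hA3 : AssumptionA3 D K₁) {x : ℂ} (hx : x ∈ D) {r : ℂ}
    (hr : ∀ η : ℝ, r * Complex.exp (η * Complex.I) ∈ D) :
    ∃ C : ℝ, 0 ≤ C ∧ ∀ n : ℕ, 1 ≤ n →
      ‖∫ η in (0 : ℝ)..(2 * Real.pi), (K₁ x (r * Complex.exp (η * Complex.I)) : ℂ)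
        * Complex.exp (Complex.I * n * η)‖ ≤ C / (n : ℝ) ^ 4 := by
  obtain ⟨k, hk, hK⟩ := hA3
  refine exists_norm_integral_mul_exp_le 4 ?_ ?_
  · have h1 : ContDiff ℝ k fun η : ℝ => (x, r * Complex.exp (η * Complex.I)) :=
      contDiff_const.prodMk (contDiff_const.mul
        ((Complex.ofRealCLM.contDiff.mul contDiff_const).cexp))
    have h2 : ContDiff ℝ k fun η : ℝ => K₁ x (r * Complex.exp (η * Complex.I)) :=
      hK.comp_contDiff h1 fun η => ⟨hx, hr η⟩
    exact (Complex.ofRealCLM.contDiff.comp h2).of_le (by exact_mod_cast hk)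
  · intro η
    have : Complex.exp (((η + 2 * Real.pi : ℝ) : ℂ) * Complex.I) = Complex.exp (η * Complex.I) := by
      rw [← Complex.exp_periodic (η * Complex.I)]
      congr 1
      push_cast
      ring
    simp only [this]

theorem exists_pCoeff_le {D : Set ℂ} {K₁ : ℂ → ℂ → ℝ}
    (hA3 : AssumptionA3 D K₁) {b : ℝ} (hb : b ∈ Ioc (0 : ℝ) 1)
    (hsub : ∀ x : ℂ, b ≤ ‖x‖ → ‖x‖ ≤ 1 → x ∈ D) :
    ∃ C : ℝ, ∀ n : ℕ, 1 ≤ n → ‖pCoeff K₁ n b‖ + ‖pTildeCoeff K₁ n b‖ ≤ C / (n : ℝ) ^ 4 := by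
  have hbD : (b : ℂ) ∈ D := by
    have : ‖(b : ℂ)‖ = b := by simp [abs_of_pos hb.1]
    exact hsub _ this.ge (by rw [this]; exact hb.2)
  obtain ⟨C₁, -, h1⟩ := exists_norm_integral_kernel_le hA3 hbD (r := b) fun η => by
    have : ‖(b : ℂ) * Complex.exp (η * Complex.I)‖ = b := by simp [abs_of_pos hb.1]
    exact hsub _ this.ge (by rw [this]; exact hb.2)
  obtain ⟨C₂, -, h2⟩ := exists_norm_integral_kernel_le hA3 hbD (r := 1) fun η => by
    have : ‖(1 : ℂ) * Complex.exp (η * Complex.I)‖ = 1 := by simp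
    exact hsub _ (by rw [this]; exact hb.2) this.le
  refine ⟨C₁ + C₂, fun n hn => ?_⟩
  have h3 := h2 n hn
  simp only [one_mul] at h3
  rw [add_div]
  exact add_le_add (h1 n hn) h3

/-! ### Identification of the coefficients and conclusion. -/

theorem lambdaCoeff_eq_cosCoeff {K₀ : ℝ → ℝ} {b : ℝ}
    (hint : IntervalIntegrable (profile K₀ (2 * b) 1) volume 0 (2 * Real.pi)) (n : ℕ) :
    lambdaCoeff K₀ n b = (cosCoeff (profile K₀ (2 * b) 1) n : ℂ) := by
  rw [← integral_mul_exp_eq_cosCoeff hint (profile_two_pi_sub _ _ _)]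
  simp only [lambdaCoeff, profile, one_mul, ← Real.sin_sq, Real.sqrt_sq_eq_abs]

/-- `|b - e^{iη}|² = (1 + b)² - 4b cos² (η / 2)`. -/
theorem norm_sub_exp_eq {b : ℝ} (hb : 0 < b) (η : ℝ) :
    ‖(b : ℂ) - Complex.exp (η * Complex.I)‖
      = (1 + b) * √(1 - 4 * b / (1 + b) ^ 2 * Real.cos (η / 2) ^ 2) := by
  have hb1 : (1 + b) ≠ 0 := by positivity
  have h1 : (b : ℂ) - Complex.exp (η * Complex.I) = ⟨b - Real.cos η, -Real.sin η⟩ := by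
    apply Complex.ext
    · simp [Complex.exp_ofReal_mul_I_re]
    · simp [Complex.exp_ofReal_mul_I_im]
  have h2 : Real.cos (η / 2) ^ 2 = (1 + Real.cos η) / 2 := by
    rw [Real.cos_sq, mul_div_cancel₀ η two_ne_zero]
    ring
  rw [← Real.sqrt_sq (show 0 ≤ 1 + b by positivity), ← Real.sqrt_mul (by positivity),
    Complex.norm_eq_sqrt_sq_add_sq, h1, Real.sqrt_sq (by positivity)]
  congr 1
  simp only [h2]
  field_simp
  linear_combination 2 * Real.sin_sq_add_cos_sq η

theorem lambdaTildeCoeff_eq_cosCoeff {K₀ : ℝ → ℝ} {b : ℝ} (hb : 0 < b)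
    (hint : IntervalIntegrable (profile K₀ (1 + b) (4 * b / (1 + b) ^ 2)) volume 0
      (2 * Real.pi)) (n : ℕ) :
    lambdaTildeCoeff K₀ n b = (cosCoeff (profile K₀ (1 + b) (4 * b / (1 + b) ^ 2)) n : ℂ) := by
  rw [← integral_mul_exp_eq_cosCoeff hint (profile_two_pi_sub _ _ _)]
  simp only [lambdaTildeCoeff, profile, norm_sub_exp_eq hb]

theorem mainTheorem6 (D : Set ℂ) (hD : IsRadialDomain D)
    (K₀ : ℝ → ℝ) (K₁ : ℂ → ℂ → ℝ) (α : ℝ) (hα : α ∈ Set.Ioo (0 : ℝ) 1)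
    (hA1 : AssumptionA1 K₀) (hA2 : AssumptionA2 K₀ α)
    (hA3 : AssumptionA3 D K₁) (hA4 : AssumptionA4 D K₁)
    (b : ℝ) (hb : b ∈ Set.Ioc (0 : ℝ) 1) :
    (∃ C : ℝ, 1 ≤ C ∧ ∀ n : ℕ, 1 ≤ n →
      (lambdaCoeff K₀ n b).im = 0 ∧
      1 / (C * (n : ℝ) ^ 2) ≤ (lambdaCoeff K₀ n b).re ∧
      (lambdaCoeff K₀ n b).re ≤ C / (n : ℝ) ^ (α - α ^ 2) ∧
      1 / (C * (n : ℝ) ^ 3) ≤ (lambdaCoeff K₀ n b).re - (lambdaCoeff K₀ (n + 1) b).re ∧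
      (lambdaCoeff K₀ n b).re - (lambdaCoeff K₀ (n + 1) b).re
        ≤ C / (n : ℝ) ^ (1 + α - α ^ 2) ∧
      ((∀ x : ℂ, b ≤ ‖x‖ → ‖x‖ ≤ 1 → x ∈ D) →
        ‖pCoeff K₁ n b‖ + ‖pTildeCoeff K₁ n b‖ ≤ C / (n : ℝ) ^ 4)) ∧
    (∀ n : ℕ, 1 ≤ n → (lambdaTildeCoeff K₀ n b).im = 0 ∧ 0 < (lambdaTildeCoeff K₀ n b).re) ∧
    (b < 1 → ∀ k : ℕ, 1 ≤ k → ∃ C : ℝ, 0 < C ∧ ∀ n : ℕ, 1 ≤ n →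
      (lambdaTildeCoeff K₀ n b).re ≤ C / (n : ℝ) ^ k) := by
  have hb0 := hb.1
  have hβ0 : 0 ≤ α - α ^ 2 := by nlinarith [hα.1, hα.2]
  have hβ1 : α - α ^ 2 < 1 := by nlinarith [hα.1, hα.2, sq_nonneg α]
  have hint : IntegrableOn (fun t : ℝ => |K₀ t| * t ^ (-(α - α ^ 2))) (Ioo 0 1) := by
    rw [neg_sub, sub_eq_neg_add]
    exact hA2
  have hone : (1 : ℝ) ∈ Ioc (0 : ℝ) 1 := ⟨one_pos, le_rfl⟩
  have hT : 0 < 2 * b := by positivity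
  have hT' : 0 < 1 + b := by positivity
  have hq0 : 0 < 4 * b / (1 + b) ^ 2 := by positivity
  have hq : 4 * b / (1 + b) ^ 2 ∈ Ioc (0 : ℝ) 1 :=
    ⟨hq0, (div_le_one (by positivity)).2 (by nlinarith [sq_nonneg (1 - b)])⟩
  have hlam := lambdaCoeff_eq_cosCoeff (hA1.intervalIntegrable_profile hβ0 hβ1 hint hT hone)
  have htil := lambdaTildeCoeff_eq_cosCoeff hb0
    (hA1.intervalIntegrable_profile hβ0 hβ1 hint hT' hq)
  refine ⟨?_, fun n hn => ?_, fun hb1 k _ => ?_⟩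
  · obtain ⟨C₁, hC₁, hup⟩ := hA1.exists_cosCoeff_le hβ0 hβ1 hint hT
    obtain ⟨c, -, -, hc⟩ := hA1.isCosWeightSum hβ0 hβ1 hint hT
    have hA : 0 < -deriv K₀ (2 * b) * (2 * b) := mul_pos (neg_pos.2 (hA1.deriv_neg hT)) hT
    have hlow := fun n (hn : 1 ≤ n) => hA1.le_cosCoeff hβ0 hβ1 hint hT (n := n) hn
    set A := -deriv K₀ (2 * b) * (2 * b)
    obtain ⟨C₂, hC₂, hp⟩ : ∃ C₂ : ℝ, 0 ≤ C₂ ∧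
        ((∀ x : ℂ, b ≤ ‖x‖ → ‖x‖ ≤ 1 → x ∈ D) → ∀ n : ℕ, 1 ≤ n →
          ‖pCoeff K₁ n b‖ + ‖pTildeCoeff K₁ n b‖ ≤ C₂ / (n : ℝ) ^ 4) := by
      by_cases hsub : ∀ x : ℂ, b ≤ ‖x‖ → ‖x‖ ≤ 1 → x ∈ D
      · obtain ⟨C, hC⟩ := exists_pCoeff_le hA3 hb hsub
        refine ⟨|C|, abs_nonneg _, fun _ n hn => (hC n hn).trans ?_⟩
        gcongr
        exact le_abs_self C
      · exact ⟨0, le_rfl, fun h => absurd h hsub⟩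
    have hA' : 0 < 2 / A := by positivity
    -- The summand `2 / A` serves both lower bounds (the 2 comes from the cubic one), `8 * C₁` both
    -- upper bounds, and `C₂` the smooth part.
    refine ⟨1 + 2 / A + 8 * C₁ + C₂, by linarith, fun n hn => ?_⟩
    set C := 1 + 2 / A + 8 * C₁ + C₂ with hC
    have hC0 : 0 < C := by positivity
    have hn0 : (0 : ℝ) < n := by exact_mod_cast hn
    have hCA : 2 ≤ C * A := by
      have : 2 = 2 / A * A := by field_simp
      rw [this]
      gcongr
      linarith
    simp only [hlam, Complex.ofReal_im, Complex.ofReal_re]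
    refine ⟨trivial, le_trans ?_ (hlow n hn).1, (hup n hn).trans ?_, le_trans ?_ (hlow n hn).2,
      ((hc 1 hone).sub_succ_le hβ0 hβ1.le hup hn).trans ?_, fun hsub => (hp hsub n hn).trans ?_⟩
    · rw [div_le_div_iff₀ (by positivity) (by positivity)]
      have : 0 < (n : ℝ) ^ 2 := by positivity
      nlinarith
    · gcongr
      linarith
    · rw [div_le_div_iff₀ (by positivity) (by positivity)]
      have : 0 < (n : ℝ) ^ 3 := by positivity
      nlinarith
    · rw [add_sub_assoc]
      gcongr
      linarith
    · gcongr
      linarith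
  · rw [htil, Complex.ofReal_im, Complex.ofReal_re]
    exact ⟨rfl, hA1.cosCoeff_profile_pos hβ0 hβ1 hint hT' hq hn⟩
  · have hq1 : 4 * b / (1 + b) ^ 2 < 1 := by
      rw [div_lt_one (by positivity)]
      nlinarith [mul_pos (sub_pos.2 hb1) (sub_pos.2 hb1)]
    obtain ⟨s, hs, C, hC⟩ :=
      hA1.exists_cosCoeff_profile_le_geometric hβ0 hβ1 hint hT' ⟨hq0, hq1⟩
    obtain ⟨C', hC', h⟩ := exists_mul_pow_le_div_pow hs C k
    refine ⟨C', hC', fun n hn => ?_⟩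
    rw [htil, Complex.ofReal_re]
    exact (hC n hn).trans (h n hn)
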